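/- Let $\mathcal N(u)=\{\exp(u^2)-1-u^2\}\,u$ and consider the exponential nonlinear Klein–Gordon equation $$u_{tt}-u_{xx}+u+\mathcal N(u)=0,\qquad u:\mathbb R_t\times\mathbb R_x\to\mathbb R. \tag{1}$$ A global solution is a function $u$ with $(u,u_t)\in C(\mathbb R;H^1(\mathbb R)\times L^2(\mathbb R))$ that satisfies (1) in the sense of distributions. Write $\langle\xi\rangle=(1+\xi^2)^{1/2}$ and $\hat f(\xi)=(2\pi)^{-1/2}\int e^{-ix\xi}f(x)\,dx$ (Fourier transform in $x$). A global solution $u$ is almost periodic modulo translations if there are functions $x:\mathbb R\to\mathbb R$ and $C:(0,\infty)\to(0,\infty)$ such that for all $t\in\mathbb R$ and $\eta>0$ $$\int_{|x-x(t)|>C(\eta)}\bigl(|u(t,x)|^2+|u_x(t,x)|^2+|u_t(t,x)|^2\bigr)dx<\eta,\qquad \int_{|\xi|>C(\eta)}\bigl(|\langle\xi\rangle\hat u(t,\xi)|^2+|\hat u_t(t,\xi)|^2\bigr)d\xi<\eta .$$ It has zero momentum if the conserved quantity $P(u)=-\int_{\mathbb R}u_t\,u_x\,dx$ vanishes (equivalently,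 vanishes at $t=0$). It is scattering if $\langle\partial_x\rangle^{s-1/2}u\in L^6(\mathbb R_t\times\mathbb R_x)$ for every $s\in(\tfrac12,\tfrac{11}{12})$ and there are real-valued $(u_0^\pm,u_1^\pm)\in H^1(\mathbb R)\times L^2(\mathbb R)$ such that $$\begin{pmatrix}u(t)\\u_t(t)\end{pmatrix}-\begin{pmatrix}\cos(t\langle\partial_x\rangle)&\langle\partial_x\rangle^{-1}\sin(t\langle\partial_x\rangle)\\-\langle\partial_x\rangle\sin(t\langle\partial_x\rangle)&\cos(t\langle\partial_x\rangle)\end{pmatrix}\begin{pmatrix}u_0^\pm\\u_1^\pm\end{pmatrix}\to 0\quad\text{in }H^1(\mathbb R)\times L^2(\mathbb R)\text{ as }t\to\pm\infty ;$$ otherwise it is non-scattering. Theorem. There is no non-scattering global solution of (1) that is almost periodic modulo translations and has zero momentum. -/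

import Mathlib

open MeasureTheory Filter Topology
open scoped ENNReal ContDiff

namespace NLKG

/-- The real Hilbert space `L²(ℝ)` of real-valued functions on the line. -/
abbrev L2 : Type := Lp ℝ 2 (volume : Measure ℝ)

/-- The exponential nonlinearity `𝒩(y) = (exp(y²) - 1 - y²) y`. -/
noncomputable def nonlin (y : ℝ) : ℝ := (Real.exp (y ^ 2) - 1 - y ^ 2) * y

/-- Test functions on the line: smooth with compact support. -/
def IsTest (φ : ℝ → ℝ) : Prop := ContDiff ℝ ∞ φ ∧ HasCompactSupport φ

/-- `g ∈ L²` is the weak derivative of `f ∈ L²`; thus `f ∈ H¹(ℝ)` iff it has such a `g`. -/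
def HasWeakDeriv (f g : L2) : Prop :=
  ∀ φ : ℝ → ℝ, IsTest φ → ∫ x, f x * deriv φ x = - ∫ x, g x * φ x

/-- `f ∈ H¹(ℝ)`. -/
def MemH1 (f : L2) : Prop := ∃ g : L2, HasWeakDeriv f g

/-- `u` is a global strong (energy) solution of `u_tt - u_xx + u + 𝒩(u) = 0`, with space
derivative `ux` and time derivative `ut`: the pair `(u, ut)` belongs to `C(ℝ; H¹ × L²)`, and the
equation holds in the sense of distributions. (By continuity in time, the distributional equation
on `ℝ × ℝ` is the same as the equation tested with functions of `x` at every time `t`. Continuity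
of `u` in `L²` follows from `hasDerivAt`, and `u` and `ux` are continuous into `L²` exactly
when `u` is continuous into `H¹`.) -/
structure IsGlobalSolution (u ux ut : ℝ → L2) : Prop where
  weakDeriv : ∀ t, HasWeakDeriv (u t) (ux t)
  continuous_ux : Continuous ux
  hasDerivAt : ∀ t, HasDerivAt u (ut t) t
  continuous_ut : Continuous ut
  equation : ∀ φ : ℝ → ℝ, IsTest φ → ∀ t,
    HasDerivAt (fun s => ∫ x, ut s x * φ x)
      (- (∫ x, ux t x * deriv φ x) - (∫ x, u t x * φ x) - ∫ x, nonlin (u t x) * φ x) t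

/-- The momentum `P = - ∫ u_t u_x dx`. -/
noncomputable def momentum (fx ft : L2) : ℝ := - ∫ x, ft x * fx x

/-- The Japanese bracket `⟨ξ⟩ = (1 + ξ²)^{1/2}`. -/
noncomputable def bracket (ξ : ℝ) : ℝ := Real.sqrt (1 + ξ ^ 2)

/-- The Fourier transform `(2π)^{-1/2} ∫ e^{-ixξ} f(x) dx` of `f ∈ L²`. Mathlib's transform has
the kernel `e^{-2πixξ}`, hence the rescaling. As an `L²` function it is defined up to null sets. -/
noncomputable def fourier (f : L2) (ξ : ℝ) : ℂ :=
  ((Real.sqrt (2 * Real.pi))⁻¹ : ℝ) *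
    (FourierTransform.fourier (Complex.ofRealCLM.compLp f : Lp ℂ 2 (volume : Measure ℝ)) :
      Lp ℂ 2 (volume : Measure ℝ)) (ξ / (2 * Real.pi))

/-- Almost periodicity modulo translations in `H¹ × L²`: `c` is the spatial center function and
`C` the compactness modulus function. -/
def AlmostPeriodicModTranslations (u ux ut : ℝ → L2) : Prop :=
  ∃ (c : ℝ → ℝ) (C : ℝ → ℝ), (∀ η, 0 < η → 0 < C η) ∧ ∀ t η : ℝ, 0 < η →
    (∫⁻ x in {x : ℝ | C η < |x - c t|},
        ENNReal.ofReal (|u t x| ^ 2 + |ux t x| ^ 2 + |ut t x| ^ 2)) < ENNReal.ofReal η ∧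
    (∫⁻ ξ in {ξ : ℝ | C η < |ξ|},
        ENNReal.ofReal ((bracket ξ * ‖fourier (u t) ξ‖) ^ 2 + ‖fourier (ut t) ξ‖ ^ 2))
      < ENNReal.ofReal η

/-- The `H¹ × L²` distance, at time `t`, between the state `(f, g)` and the solution of the linear
Klein-Gordon equation with data `(f₀, g₀)` at time `0`, written on the Fourier side (Plancherel):
the linear solution and its time derivative have the transforms
`cos(t⟨ξ⟩) f̂₀ + ⟨ξ⟩⁻¹ sin(t⟨ξ⟩) ĝ₀` and `-⟨ξ⟩ sin(t⟨ξ⟩) f̂₀ + cos(t⟨ξ⟩) ĝ₀`. -/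
noncomputable def distToLinear (f g f₀ g₀ : L2) (t : ℝ) : ℝ≥0∞ :=
  eLpNorm (fun ξ : ℝ => (bracket ξ : ℂ) * (fourier f ξ -
      ((Real.cos (t * bracket ξ) : ℂ) * fourier f₀ ξ +
        ((bracket ξ)⁻¹ * Real.sin (t * bracket ξ) : ℝ) * fourier g₀ ξ))) 2 volume +
  eLpNorm (fun ξ : ℝ => fourier g ξ -
      ((-(bracket ξ) * Real.sin (t * bracket ξ) : ℝ) * fourier f₀ ξ +
        (Real.cos (t * bracket ξ) : ℂ) * fourier g₀ ξ)) 2 volume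

/-- `(u, ut)` converges to a linear solution in `H¹ × L²` along the filter `l` of times. -/
def ScattersAlong (u ut : ℝ → L2) (l : Filter ℝ) : Prop :=
  ∃ f₀ g₀ : L2, MemH1 f₀ ∧ Tendsto (fun t => distToLinear (u t) (ut t) f₀ g₀ t) l (𝓝 0)

/-- `g = ⟨∂ₓ⟩^σ f`, i.e. `ĝ(ξ) = ⟨ξ⟩^σ f̂(ξ)`. -/
def IsBesselPotential (σ : ℝ) (f g : L2) : Prop :=
  ∀ᵐ ξ : ℝ, fourier g ξ = ((bracket ξ ^ σ : ℝ) : ℂ) * fourier f ξ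

/-- `⟨∂ₓ⟩^σ u` belongs to `L⁶(ℝ × ℝ)`. For `u(t) ∈ H¹` and `σ ≤ 1`, the function
`⟨∂ₓ⟩^σ u(t) ∈ L²` exists and is unique. -/
def FiniteScatteringSize (σ : ℝ) (u : ℝ → L2) : Prop :=
  ∃ g : ℝ → L2, (∀ t, IsBesselPotential σ (u t) (g t)) ∧
    (∫⁻ t, ∫⁻ x, ‖g t x‖ₑ ^ 6) < ⊤

/-- Scattering, forward and backward in time: `⟨∂ₓ⟩^{s-1/2} u ∈ L⁶(ℝ × ℝ)` for
`1/2 < s < 11/12`, and convergence to linear solutions in `H¹ × L²` as `t → ± ∞`. -/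
def Scatters (u ut : ℝ → L2) : Prop :=
  (∀ s : ℝ, 1 / 2 < s → s < 11 / 12 → FiniteScatteringSize (s - 1 / 2) u) ∧
    ScattersAlong u ut atTop ∧ ScattersAlong u ut atBot

end NLKG

/-!
An almost periodic solution of zero momentum has zero energy; it therefore vanishes and scatters
trivially.

The engine is a virial argument. Let `e` be the energy density, `p = uₜ uₓ`, and let `F` be the
primitive of `𝒩`. For the truncated functional `V = ∫ φ p + ½ ∫ φ' u uₜ`, where `φ(x) = x` on a
large interval `[-R, R]`, one has `V' = -∫ (uₓ² + ½ u 𝒩(u) - F(u))` up to the energy outside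
`[-R, R]`, and `½ u 𝒩(u) - F(u) ≥ 0` (`two_mul_potential_le`). Compactness gives
`‖u‖² ≤ η + K_η ‖uₓ‖²` for all times (`norm_sq_le_of_tail`), and `∫ u uₜ` has derivative
`‖uₜ‖² - ‖uₓ‖² - ‖u‖² - ∫ u 𝒩(u)`; hence `Z = ∫ φ' u uₜ - A V` grows at least like `E t`, where `E`
is the conserved energy, while `|Z| = O(R E)`. If `R = κ T + C` with small `κ` is large enough to
contain the bulk of the solution on `[0, T]`, this forces `E = 0` (`IsLocalized.false_of_virial`).

That such an `R` exists is where the momentum enters. A cutoff of the energy at scale `R ∼ L T`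
changes slowly, so the center `c(t)` of the solution satisfies `|c(t)| ≤ L T + C`
(`exists_linear_bound`); then the first moment of the energy truncated at scale `L T`, whose
derivative is the total momentum up to tails, is constant up to `ε T`, and it equals `c(t) E` up to
`ε T`, whence `|c(t)| ≤ κ T + C` for each `κ > 0` (`exists_sublinear_bound`).

The local conservation laws have to be derived for solutions of finite energy. In one dimension
`uₜ ± uₓ` solve the transport equations `(∂ₜ ∓ ∂ₓ) v = -(u + 𝒩(u))`. In the frame moving with the
characteristics a weak solution of a transport equation is strongly differentiable in `L²`
(`IsTransport.hasDerivAt_shift`), so that weighted integrals of quadratic or `C^{1,1}` functions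
of it can be differentiated (`IsTransport.hasDerivAt_integral_comp`). Applied to functions constant
in time, the same lemma gives the chain rule in `H¹` and the bound `sup f² ≤ 2 ‖f‖ ‖f'‖`
(`HasWeakDeriv.ae_sq_le`), which controls the exponential nonlinearity.
-/

namespace NLKG

/-! ### Products and inner products in `L²(ℝ)` -/

lemma integrable_mul (f g : L2) : Integrable (fun x => f x * g x) :=
  (Lp.memLp f).integrable_mul (Lp.memLp g)

lemma integrable_sq (f : L2) : Integrable (fun x => f x ^ 2) := (Lp.memLp f).integrable_sq

lemma inner_eq_integral (f g : L2) : inner ℝ f g = ∫ x, f x * g x := by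
  rw [L2.inner_def]
  exact integral_congr_ae (Eventually.of_forall fun x => by simp [mul_comm])

lemma integral_sq_eq (f : L2) : ∫ x, f x ^ 2 = ‖f‖ ^ 2 := by
  rw [← real_inner_self_eq_norm_sq, inner_eq_integral]
  simp only [sq]

lemma abs_integral_mul_le (f g : L2) : |∫ x, f x * g x| ≤ ‖f‖ * ‖g‖ := by
  rw [← inner_eq_integral]
  exact abs_real_inner_le_norm f g

/-! ### Test functions -/

namespace IsTest

variable {φ : ℝ → ℝ}

lemma continuous (h : IsTest φ) : Continuous φ := h.1.continuous

lemma differentiable (h : IsTest φ) : Differentiable ℝ φ :=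
  h.1.differentiable (by simp)

lemma hasDerivAt (h : IsTest φ) (x : ℝ) : HasDerivAt φ (deriv φ x) x :=
  (h.differentiable x).hasDerivAt

lemma deriv (h : IsTest φ) : IsTest (deriv φ) :=
  ⟨(contDiff_infty_iff_deriv.1 h.1).2, h.2.deriv⟩

lemma comp_add (h : IsTest φ) (y : ℝ) : IsTest (fun x => φ (x + y)) :=
  ⟨h.1.comp (contDiff_id.add contDiff_const), h.2.comp_homeomorph (Homeomorph.addRight y)⟩

lemma mul {ψ : ℝ → ℝ} (h : IsTest φ) (hψ : ContDiff ℝ ∞ ψ) : IsTest (fun x => ψ x * φ x) :=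
  ⟨hψ.mul h.1, h.2.mul_left⟩

lemma exists_bound (h : IsTest φ) : ∃ B, 0 ≤ B ∧ ∀ x, |φ x| ≤ B := by
  obtain ⟨B, hB⟩ := h.2.exists_bound_of_continuous h.continuous
  exact ⟨B, (norm_nonneg _).trans (hB 0), hB⟩

lemma memLp (h : IsTest φ) : MemLp φ 2 (volume : Measure ℝ) :=
  h.continuous.memLp_of_hasCompactSupport h.2

lemma integrable_mul_of_integrable (h : IsTest φ) {F : ℝ → ℝ} (hF : Integrable F) :
    Integrable (fun x => φ x * F x) := by
  obtain ⟨B, -, hB⟩ := h.exists_bound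
  exact hF.bdd_mul h.continuous.aestronglyMeasurable (Eventually.of_forall hB)

/-- Second order Taylor bound, uniform on the line. -/
lemma exists_taylor_bound (h : IsTest φ) :
    ∃ B, 0 ≤ B ∧ ∀ x y, |φ (x + y) - φ x - y * _root_.deriv φ x| ≤ B * y ^ 2 := by
  obtain ⟨B, hB0, hB⟩ := h.deriv.deriv.exists_bound
  refine ⟨B, hB0, fun x y => ?_⟩
  have hd : ∀ z, |_root_.deriv φ z - _root_.deriv φ x| ≤ B * |z - x| := fun z =>
    Convex.norm_image_sub_le_of_norm_deriv_le (f := _root_.deriv φ) (s := Set.univ)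
      (fun w _ => h.deriv.differentiable w) (fun w _ => hB w) convex_univ trivial trivial
  have key := Convex.norm_image_sub_le_of_norm_hasDerivWithin_le
    (f := fun z => φ z - z * _root_.deriv φ x) (s := Set.uIcc x (x + y))
    (f' := fun z => _root_.deriv φ z - _root_.deriv φ x) (C := B * |y|) (x := x) (y := x + y)
    (fun z _ => by
      have := (h.hasDerivAt z).sub ((hasDerivAt_id z).mul_const (_root_.deriv φ x))
      rw [one_mul] at this
      exact this.hasDerivWithinAt)
    (fun z hz => by
      refine (hd z).trans (mul_le_mul_of_nonneg_left ?_ hB0)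
      have := Set.abs_sub_left_of_mem_uIcc hz
      simpa using this)
    (convex_uIcc _ _) Set.left_mem_uIcc Set.right_mem_uIcc
  have e : (φ (x + y) - (x + y) * _root_.deriv φ x) - (φ x - x * _root_.deriv φ x)
    = φ (x + y) - φ x - y * _root_.deriv φ x := by ring
  simp only [Real.norm_eq_abs, add_sub_cancel_left] at key
  rw [e] at key
  calc _ ≤ B * |y| * |y| := key
    _ = B * y ^ 2 := by rw [mul_assoc, ← sq, sq_abs]

end IsTest

/-- A test function, as an element of `L²`. -/
noncomputable def testLp {φ : ℝ → ℝ} (h : IsTest φ) : L2 := h.memLp.toLp φ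

lemma coeFn_testLp {φ : ℝ → ℝ} (h : IsTest φ) : testLp h =ᵐ[volume] φ := h.memLp.coeFn_toLp

lemma inner_testLp (f : L2) {φ : ℝ → ℝ} (h : IsTest φ) :
    inner ℝ f (testLp h) = ∫ x, f x * φ x := by
  rw [inner_eq_integral]
  refine integral_congr_ae ?_
  filter_upwards [coeFn_testLp h] with x hx
  rw [hx]

lemma eq_zero_of_integral_mul_test_eq_zero (f : L2)
    (h : ∀ φ : ℝ → ℝ, IsTest φ → ∫ x, f x * φ x = 0) : f = 0 := by
  rw [Lp.eq_zero_iff_ae_eq_zero]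
  refine ae_eq_zero_of_integral_contDiff_smul_eq_zero
    ((Lp.memLp f).locallyIntegrable (by norm_num)) fun φ h1 h2 => ?_
  rw [← h φ ⟨h1, h2⟩]
  simp [mul_comm]

/-! ### Translations on `L²(ℝ)` -/

/-- The translation `f ↦ f(· + y)` on `L²`. -/
noncomputable def shift (y : ℝ) (f : L2) : L2 :=
  Lp.compMeasurePreserving (fun x => x + y) (measurePreserving_add_right volume y) f

lemma coeFn_shift (y : ℝ) (f : L2) : shift y f =ᵐ[volume] fun x => f (x + y) :=
  Lp.coeFn_compMeasurePreserving f _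

lemma ae_comp_add {P : ℝ → Prop} (h : ∀ᵐ x : ℝ, P x) (y : ℝ) : ∀ᵐ x : ℝ, P (x + y) :=
  (measurePreserving_add_right volume y).quasiMeasurePreserving.ae h

lemma shift_zero (f : L2) : shift 0 f = f := by
  refine Lp.ext ?_
  filter_upwards [coeFn_shift 0 f] with x hx
  simpa using hx

lemma shift_shift (y z : ℝ) (f : L2) : shift y (shift z f) = shift (y + z) f := by
  refine Lp.ext ?_
  filter_upwards [coeFn_shift y (shift z f), coeFn_shift (y + z) f,
    ae_comp_add (coeFn_shift z f) y] with x h1 h2 h3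
  rw [h1, h2, h3, add_assoc]

/-- The translation as a continuous linear map. -/
noncomputable def shiftL (y : ℝ) : L2 →L[ℝ] L2 :=
  (Lp.compMeasurePreservingₗᵢ ℝ (fun x => x + y)
    (measurePreserving_add_right volume y)).toContinuousLinearMap

lemma shiftL_apply (y : ℝ) (f : L2) : shiftL y f = shift y f := rfl

lemma continuous_shift {a : ℝ → L2} (ha : Continuous a) (c : ℝ) :
    Continuous (fun s => shift (c * s) (a s)) := by
  refine Continuous.compMeasurePreservingLp
    (g := fun s => (⟨fun x => x + c * s, by fun_prop⟩ : C(ℝ, ℝ))) ha ?_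
    (fun s => measurePreserving_add_right volume (c * s)) (by norm_num)
  exact ContinuousMap.continuous_of_continuous_uncurry _
    (by simp only [Function.uncurry_def, ContinuousMap.coe_mk]; fun_prop)

lemma integral_comp_shift (H : ℝ → ℝ → ℝ) (y : ℝ) (f : L2) :
    ∫ x, H x (shift y f x) = ∫ x, H (x - y) (f x) := by
  have : ∫ x, H x (shift y f x) = ∫ x, H (x + y - y) (f (x + y)) := by
    refine integral_congr_ae ?_
    filter_upwards [coeFn_shift y f] with x hx
    simp only [hx, add_sub_cancel_right]
  rw [this, integral_add_right_eq_self (fun x => H (x - y) (f x))]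

/-- A translated test function is differentiable in `L²` with respect to the translation. -/
lemma hasDerivAt_shift_testLp {φ : ℝ → ℝ} (h : IsTest φ) (c s : ℝ) :
    HasDerivAt (fun s => shift (c * s) (testLp h)) (c • shift (c * s) (testLp h.deriv)) s := by
  suffices h0 : HasDerivAt (fun y => shift y (testLp h)) (testLp h.deriv) 0 by
    have h1 : HasDerivAt (fun σ => c * σ - c * s) c s := by
      simpa using ((hasDerivAt_id s).const_mul c).sub_const (c * s)
    have h2 := (shiftL (c * s)).hasFDerivAt.comp_hasDerivAt s
      (HasDerivAt.scomp s (by simpa using h0) h1)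
    simp only [map_smul, shiftL_apply] at h2
    refine h2.congr_of_eventuallyEq (Eventually.of_forall fun σ => ?_)
    simp [Function.comp_def, shiftL_apply, shift_shift]
  obtain ⟨B, hB0, hB⟩ := h.exists_taylor_bound
  obtain ⟨R, hR⟩ := h.2.isCompact.isBounded.subset_closedBall 0
  have hR' : ∀ x, R < |x| → φ x = 0 ∧ deriv φ x = 0 := by
    intro x hx
    have hx' : x ∉ tsupport φ := fun hmem => by
      have := hR hmem
      simp at this
      linarith
    exact ⟨image_eq_zero_of_notMem_tsupport hx',
      by by_contra hne; exact hx' (support_deriv_subset hne)⟩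
  have hfin : volume (Set.Icc (-(R + 1)) (R + 1)) ≠ ⊤ := by simp
  -- For `|y| < 1` the Taylor remainder of order `y²` is supported in a fixed interval.
  set χ : L2 := indicatorConstLp 2 (measurableSet_Icc (a := -(R + 1)) (b := R + 1)) hfin (1 : ℝ)
    with hχ
  rw [hasDerivAt_iff_isLittleO]
  have hO : (fun y : ℝ => shift y (testLp h) - shift 0 (testLp h) - (y - 0) • testLp h.deriv)
      =O[𝓝 0] fun y => y ^ 2 := by
    refine Asymptotics.IsBigO.of_bound (B * ‖χ‖) ?_
    filter_upwards [Metric.ball_mem_nhds (0 : ℝ) one_pos] with y hy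
    have hy1 : |y| < 1 := by simpa using hy
    have : ‖shift y (testLp h) - shift 0 (testLp h) - (y - 0) • testLp h.deriv‖
        ≤ (B * y ^ 2) * ‖χ‖ := by
      refine Lp.norm_le_mul_norm_of_ae_le_mul ?_
      filter_upwards [Lp.coeFn_sub (shift y (testLp h) - shift 0 (testLp h))
        ((y - 0) • testLp h.deriv), Lp.coeFn_sub (shift y (testLp h)) (shift 0 (testLp h)),
        Lp.coeFn_smul (y - 0) (testLp h.deriv), coeFn_testLp h, coeFn_testLp h.deriv,
        coeFn_shift y (testLp h), ae_comp_add (coeFn_testLp h) y,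
        indicatorConstLp_coeFn (p := 2) (hs := measurableSet_Icc (a := -(R + 1)) (b := R + 1))
          (hμs := hfin) (c := (1 : ℝ))] with x h1 h2 h3 h4 h5 h6 h7 h8
      rw [h1, Pi.sub_apply, h2, h3, Pi.sub_apply, Pi.smul_apply, h6, h7, shift_zero, h4, h5, hχ, h8]
      simp only [sub_zero, smul_eq_mul, Real.norm_eq_abs]
      by_cases hx : x ∈ Set.Icc (-(R + 1)) (R + 1)
      · rw [Set.indicator_of_mem hx]
        simpa using hB x y
      · have hx' : R + 1 < |x| := by
          by_contra hcon
          exact hx (abs_le.1 (not_lt.1 hcon))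
        have h1 := hR' x (by linarith)
        have h2 := hR' (x + y) (by
          have := abs_sub_abs_le_abs_sub x (-y)
          rw [abs_neg, sub_neg_eq_add] at this
          linarith)
        rw [h1.1, h1.2, h2.1, Set.indicator_of_notMem hx]
        simp
    rw [Real.norm_eq_abs, abs_of_nonneg (sq_nonneg y)]
    linarith
  refine hO.trans_isLittleO ?_
  simpa using Asymptotics.isLittleO_pow_id (𝕜 := ℝ) (n := 2) (by norm_num)

/-- Product rule for the pairing of a continuous, weakly differentiable path with a
differentiable path. -/
lemma hasDerivAt_inner_of_weak {a Φ : ℝ → L2} {s d : ℝ} {Φ' : L2} (ha : ContinuousAt a s)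
    (hw : HasDerivAt (fun σ => inner ℝ (a σ) (Φ s)) d s) (hΦ : HasDerivAt Φ Φ' s) :
    HasDerivAt (fun σ => inner ℝ (a σ) (Φ σ)) (d + inner ℝ (a s) Φ') s := by
  have h2 : HasDerivAt (fun σ => inner ℝ (a σ) (Φ σ - Φ s)) (inner ℝ (a s) Φ') s := by
    rw [hasDerivAt_iff_tendsto_slope] at hΦ ⊢
    have := (ha.tendsto.mono_left (nhdsWithin_le_nhds (s := {s}ᶜ))).inner (𝕜 := ℝ) hΦ
    refine this.congr fun σ => ?_
    simp [slope_def_module, inner_smul_right]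
  refine (hw.add h2).congr_of_eventuallyEq (Eventually.of_forall fun σ => ?_)
  simp [inner_sub_right]

/-! ### Weak solutions of transport equations -/

/-- `a` solves `∂ₜ a = c ∂ₓ a + g` in the sense of distributions in space. -/
structure IsTransport (c : ℝ) (a g : ℝ → L2) : Prop where
  continuous : Continuous a
  continuous_source : Continuous g
  weak : ∀ φ : ℝ → ℝ, IsTest φ → ∀ t,
    HasDerivAt (fun s => ∫ x, a s x * φ x)
      (-c * (∫ x, a t x * deriv φ x) + ∫ x, g t x * φ x) t

/-- Along the characteristics, a weak solution of a transport equation is strongly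
differentiable. -/
lemma IsTransport.hasDerivAt_shift {c : ℝ} {a g : ℝ → L2} (h : IsTransport c a g) (t : ℝ) :
    HasDerivAt (fun s => shift (-c * s) (a s)) (shift (-c * t) (g t)) t := by
  have hcW := continuous_shift h.continuous (-c)
  have hcg := continuous_shift h.continuous_source (-c)
  have hpair : ∀ (f : L2) {φ : ℝ → ℝ} (hφ : IsTest φ) (y : ℝ),
      inner ℝ (shift (-y) f) (testLp hφ) = inner ℝ f (shift y (testLp hφ)) := by
    intro f φ hφ y
    rw [inner_testLp, integral_comp_shift (fun x z => z * φ x), inner_eq_integral]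
    refine integral_congr_ae ?_
    filter_upwards [coeFn_shift y (testLp hφ), ae_comp_add (coeFn_testLp hφ) y] with x h1 h2
    simp only [h1, h2, sub_neg_eq_add]
  have hpair' : ∀ (f : L2) {φ : ℝ → ℝ} (hφ : IsTest φ) (y : ℝ),
      inner ℝ f (shift y (testLp hφ)) = ∫ x, f x * φ (x + y) := by
    intro f φ hφ y
    rw [inner_eq_integral]
    refine integral_congr_ae ?_
    filter_upwards [coeFn_shift y (testLp hφ), ae_comp_add (coeFn_testLp hφ) y] with x h1 h2
    simp only [h1, h2]
  have hd : ∀ {φ : ℝ → ℝ} (hφ : IsTest φ) (s : ℝ),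
      HasDerivAt (fun s => inner ℝ (shift (-c * s) (a s)) (testLp hφ))
        (inner ℝ (shift (-c * s) (g s)) (testLp hφ)) s := by
    intro φ hφ s
    have hw := h.weak _ (hφ.comp_add (c * s)) s
    simp only [deriv_comp_add_const] at hw
    have := hasDerivAt_inner_of_weak (Φ := fun s => shift (c * s) (testLp hφ))
      (h.continuous.continuousAt (x := s))
      (by simpa only [hpair'] using hw) (hasDerivAt_shift_testLp hφ c s)
    simp only [neg_mul, hpair]
    convert this using 1
    rw [inner_smul_right, hpair', hpair']
    ring
  -- The weak derivative along the characteristics is continuous, so it is a strong derivative.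
  have hint : ∀ s, shift (-c * s) (a s) =
      shift (-c * 0) (a 0) + ∫ σ in (0 : ℝ)..s, shift (-c * σ) (g σ) := by
    intro s
    rw [← sub_eq_zero, ← sub_sub]
    refine eq_zero_of_integral_mul_test_eq_zero _ fun φ hφ => ?_
    rw [← inner_testLp _ hφ, inner_sub_left, inner_sub_left]
    have e1 : inner ℝ (∫ σ in (0 : ℝ)..s, shift (-c * σ) (g σ)) (testLp hφ)
        = ∫ σ in (0 : ℝ)..s, inner ℝ (shift (-c * σ) (g σ)) (testLp hφ) := by
      rw [real_inner_comm]
      have := (innerSL ℝ (testLp hφ)).intervalIntegral_comp_comm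
        (hcg.intervalIntegrable (μ := volume) 0 s)
      simp only [innerSL_apply_apply] at this
      rw [← this]
      simp only [real_inner_comm]
    rw [e1, intervalIntegral.integral_eq_sub_of_hasDerivAt (fun σ _ => hd hφ σ)
      ((hcg.inner continuous_const).intervalIntegrable 0 s), sub_self]
  have hF := (intervalIntegral.integral_hasDerivAt_right (hcg.intervalIntegrable 0 t)
    (hcg.stronglyMeasurableAtFilter _ _) hcg.continuousAt).const_add (shift (-c * 0) (a 0))
  exact hF.congr_of_eventuallyEq (Eventually.of_forall hint)

/-! ### Nonlinear functionals along transport equations -/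

lemma integral_sub_sub {F G K : ℝ → ℝ} (hF : Integrable F) (hG : Integrable G)
    (hK : Integrable K) : ∫ x, (F x - G x - K x) = (∫ x, F x) - (∫ x, G x) - ∫ x, K x := by
  rw [← integral_sub hF hG]
  exact integral_sub (hF.sub hG) hK

lemma integral_add_add {F G K : ℝ → ℝ} (hF : Integrable F) (hG : Integrable G)
    (hK : Integrable K) : ∫ x, (F x + G x + K x) = (∫ x, F x) + (∫ x, G x) + ∫ x, K x := by
  rw [← integral_add hF hG]
  exact integral_add (hF.add hG) hK

/-- `H` is a `C^{1,1}` function on `S` with derivative `h`, vanishing to second order at `0`: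
the bounds under which `f ↦ ∫ φ H(f)` is differentiable on the `L²` functions with values
in `S`. -/
structure QuadraticBound (H h : ℝ → ℝ) (S : Set ℝ) (K : ℝ) : Prop where
  continuous : Continuous H
  continuous_deriv : Continuous h
  nonneg : 0 ≤ K
  taylor : ∀ y ∈ S, ∀ z ∈ S, |H z - H y - h y * (z - y)| ≤ K * (z - y) ^ 2
  bound : ∀ y ∈ S, |H y| ≤ K * y ^ 2
  bound_deriv : ∀ y ∈ S, |h y| ≤ K * |y|

namespace QuadraticBound

variable {H h : ℝ → ℝ} {S : Set ℝ} {K : ℝ}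

lemma integrable_comp (hH : QuadraticBound H h S K) {f : L2} (hf : ∀ᵐ x : ℝ, f x ∈ S) :
    Integrable (fun x => H (f x)) := by
  refine ((integrable_sq f).const_mul K).mono'
    (hH.continuous.comp_aestronglyMeasurable (Lp.aestronglyMeasurable f)) ?_
  filter_upwards [hf] with x hx using hH.bound _ hx

lemma abs_integral_comp_le (hH : QuadraticBound H h S K) {f : L2} (hf : ∀ᵐ x : ℝ, f x ∈ S)
    {ψ : ℝ → ℝ} {B : ℝ} (hB : ∀ x, |ψ x| ≤ B) :
    |∫ x, ψ x * H (f x)| ≤ B * K * ‖f‖ ^ 2 := by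
  rw [← integral_sq_eq, ← integral_const_mul]
  refine norm_integral_le_of_norm_le (f := fun x => ψ x * H (f x))
    ((integrable_sq f).const_mul (B * K)) ?_
  filter_upwards [hf] with x hx
  rw [Real.norm_eq_abs, abs_mul, mul_assoc]
  exact mul_le_mul (hB x) (hH.bound _ hx) (abs_nonneg _) ((abs_nonneg _).trans (hB x))

lemma memLp_deriv_comp (hH : QuadraticBound H h S K) {f : L2} (hf : ∀ᵐ x : ℝ, f x ∈ S) :
    MemLp (fun x => h (f x)) 2 (volume : Measure ℝ) := by
  refine ((Lp.memLp f).const_mul K).mono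
    (hH.continuous_deriv.comp_aestronglyMeasurable (Lp.aestronglyMeasurable f)) ?_
  filter_upwards [hf] with x hx
  simpa [abs_mul, abs_of_nonneg hH.nonneg] using hH.bound_deriv _ hx

lemma hasDerivAt_integral_comp (hH : QuadraticBound H h S K) {W : ℝ → L2} {W' : L2} {t : ℝ}
    (hW : HasDerivAt W W' t) (hS : ∀ᶠ s in 𝓝 t, ∀ᵐ x : ℝ, W s x ∈ S)
    {φ : ℝ → ℝ} (hφ : IsTest φ) :
    HasDerivAt (fun s => ∫ x, φ x * H (W s x)) (∫ x, φ x * (h (W t x) * W' x)) t := by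
  obtain ⟨B, hB0, hB⟩ := hφ.exists_bound
  have hSt := hS.self_of_nhds
  -- The linear part of the functional is the pairing with `φ h(W t) ∈ L²`.
  have hmem : MemLp (fun x => φ x * h (W t x)) 2 (volume : Measure ℝ) := by
    refine ((hH.memLp_deriv_comp hSt).const_mul B).mono
      (hφ.continuous.aestronglyMeasurable.mul (hH.memLp_deriv_comp hSt).1) ?_
    refine Eventually.of_forall fun x => ?_
    simp only [norm_mul, Real.norm_eq_abs, abs_of_nonneg hB0]
    exact mul_le_mul_of_nonneg_right (hB x) (abs_nonneg _)
  set m : L2 := hmem.toLp _ with hm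
  have hinner : ∀ f : L2, inner ℝ m f = ∫ x, φ x * (h (W t x) * f x) := by
    intro f
    rw [inner_eq_integral]
    refine integral_congr_ae ?_
    filter_upwards [hmem.coeFn_toLp] with x hx
    rw [hm, hx, mul_assoc]
  have hlin : HasDerivAt (fun s => inner ℝ m (W s - W t)) (inner ℝ m W') t := by
    have := (innerSL ℝ m).hasFDerivAt.comp_hasDerivAt t (hW.sub_const (W t))
    simpa [Function.comp_def] using this
  have hrem : HasDerivAt (fun s => (∫ x, φ x * H (W s x)) - (∫ x, φ x * H (W t x))
      - inner ℝ m (W s - W t)) 0 t := by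
    rw [hasDerivAt_iff_isLittleO]
    have hO : (fun s => W s - W t) =O[𝓝 t] fun s => s - t := hW.isBigO_sub
    have hO2 : (fun s => ‖W s - W t‖ ^ 2) =o[𝓝 t] fun s => s - t := by
      refine (hO.norm_left.pow 2).trans_isLittleO ?_
      exact Asymptotics.isLittleO_pow_sub_sub t (by norm_num : 1 < 2) |>.congr
        (fun s => by simp) (fun s => by simp)
    refine Asymptotics.IsBigO.trans_isLittleO ?_ hO2
    refine Asymptotics.IsBigO.of_bound (B * K) ?_
    filter_upwards [hS] with s hs
    have i1 := hφ.integrable_mul_of_integrable (hH.integrable_comp hs)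
    have i2 := hφ.integrable_mul_of_integrable (hH.integrable_comp hSt)
    have i3 : Integrable (fun x => m x * (W s - W t) x) := integrable_mul _ _
    simp only [sub_self, inner_zero_right, sub_zero, smul_zero]
    rw [inner_eq_integral, ← integral_sub_sub i1 i2 i3, ← integral_sq_eq, 
      Real.norm_of_nonneg (integral_nonneg fun x => sq_nonneg _),
      ← integral_const_mul]
    refine norm_integral_le_of_norm_le ((integrable_sq (W s - W t)).const_mul (B * K)) ?_
    filter_upwards [hs, hSt, hmem.coeFn_toLp, Lp.coeFn_sub (W s) (W t)] with x h1 h2 h3 h4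
    rw [hm, h3, h4, Pi.sub_apply]
    have e : φ x * H (W s x) - φ x * H (W t x) - φ x * h (W t x) * (W s x - W t x)
      = φ x * (H (W s x) - H (W t x) - h (W t x) * (W s x - W t x)) := by ring
    rw [e, Real.norm_eq_abs, abs_mul, mul_assoc]
    exact mul_le_mul (hB x) (hH.taylor _ h2 _ h1) (abs_nonneg _) hB0
  have := (hrem.add hlin).add_const (∫ x, φ x * H (W t x))
  rw [zero_add, hinner] at this
  exact this.congr_of_eventuallyEq (Eventually.of_forall fun s => by simp)

end QuadraticBound

/-- The weighted functional `∫ φ H(a)` along a transport equation `∂ₜ a = c ∂ₓ a + g`. -/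
lemma IsTransport.hasDerivAt_integral_comp {c : ℝ} {a g : ℝ → L2} (ht : IsTransport c a g)
    {H h : ℝ → ℝ} {S : Set ℝ} {K : ℝ} (hH : QuadraticBound H h S K) {t : ℝ}
    (hS : ∀ᶠ s in 𝓝 t, ∀ᵐ x : ℝ, a s x ∈ S) {φ : ℝ → ℝ} (hφ : IsTest φ) :
    HasDerivAt (fun s => ∫ x, φ x * H (a s x))
      (-c * (∫ x, deriv φ x * H (a t x)) + ∫ x, φ x * (h (a t x) * g t x)) t := by
  -- `W` is `a` seen from the frame moving with the characteristic that is at rest at time `t`.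
  set W : ℝ → L2 := fun s => shift (c * t) (shift (-c * s) (a s)) with hWdef
  have hWt : W t = a t := by simp [hWdef, shift_shift, shift_zero]
  have hW : HasDerivAt W (g t) t := by
    have := (shiftL (c * t)).hasFDerivAt.comp_hasDerivAt t (ht.hasDerivAt_shift t)
    simpa [hWdef, Function.comp_def, shiftL_apply, shift_shift, shift_zero] using this
  have hWS : ∀ᶠ s in 𝓝 t, ∀ᵐ x : ℝ, W s x ∈ S := by
    filter_upwards [hS] with s hs
    simp only [hWdef, shift_shift]
    filter_upwards [coeFn_shift (c * t + -c * s) (a s),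
      ae_comp_add hs (c * t + -c * s)] with x h1 h2
    rw [h1]
    exact h2
  have hA := hH.hasDerivAt_integral_comp hW hWS hφ
  have hA' := (hH.hasDerivAt_integral_comp hW hWS hφ.deriv).continuousAt
  obtain ⟨B, hB0, hB⟩ := hφ.exists_taylor_bound
  have hmain : HasDerivAt (fun s => (-c * (s - t)) * ∫ x, deriv φ x * H (W s x))
      (-c * ∫ x, deriv φ x * H (W t x)) t := by
    rw [hasDerivAt_iff_tendsto_slope]
    have h1 := (hA'.tendsto.const_mul (-c)).mono_left (nhdsWithin_le_nhds (s := {t}ᶜ))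
    refine h1.congr' ?_
    filter_upwards [self_mem_nhdsWithin] with s hs
    have hs' : s - t ≠ 0 := sub_ne_zero.2 hs
    rw [slope_def_field]
    field_simp
    ring
  have hrem : HasDerivAt (fun s => ∫ x, (φ (x + -c * (s - t)) - φ x
      - (-c * (s - t)) * deriv φ x) * H (W s x)) 0 t := by
    rw [hasDerivAt_iff_isLittleO]
    have hO2 : (fun s : ℝ => (s - t) ^ 2) =o[𝓝 t] fun s => s - t :=
      Asymptotics.isLittleO_pow_sub_sub t (by norm_num : 1 < 2) |>.congr
        (fun s => by simp) (fun s => by simp)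
    refine Asymptotics.IsBigO.trans_isLittleO ?_ hO2
    have hbd : ∀ᶠ s in 𝓝 t, ‖W s‖ < ‖W t‖ + 1 :=
      hW.continuousAt.norm.eventually_lt_const (by simp)
    refine Asymptotics.IsBigO.of_bound (B * c ^ 2 * K * (‖W t‖ + 1) ^ 2) ?_
    filter_upwards [hWS, hbd] with s hs hs2
    have h1 := hH.abs_integral_comp_le hs (fun x => hB x (-c * (s - t)))
    have h2 : ‖W s‖ ^ 2 ≤ (‖W t‖ + 1) ^ 2 := by gcongr
    simp only [sub_self, mul_zero, add_zero, zero_mul, integral_zero, sub_zero, smul_zero]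
    rw [Real.norm_eq_abs, Real.norm_of_nonneg (sq_nonneg _)]
    refine h1.trans ?_
    have h3 : 0 ≤ B * c ^ 2 * (s - t) ^ 2 * K := by
      have := hH.nonneg
      positivity
    nlinarith [mul_le_mul_of_nonneg_left h2 h3]
  have hsum := (hA.add hmain).add hrem
  rw [hWt, add_zero, add_comm (∫ x, φ x * (h (a t x) * g t x))] at hsum
  refine hsum.congr_of_eventuallyEq ?_
  filter_upwards [hS, hWS] with s hs hs'
  have e1 : ∫ x, φ x * H (a s x) = ∫ x, φ (x + -c * (s - t)) * H (W s x) := by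
    simp only [hWdef, shift_shift]
    rw [integral_comp_shift (fun x z => φ (x + -c * (s - t)) * H z)]
    refine integral_congr_ae (Eventually.of_forall fun x => ?_)
    simp only
    congr 2
    ring
  have i1 := hφ.integrable_mul_of_integrable (hH.integrable_comp hs')
  have i2 := (hφ.deriv.integrable_mul_of_integrable (hH.integrable_comp hs')).const_mul
    (-c * (s - t))
  have i3 := (hφ.comp_add (-c * (s - t))).integrable_mul_of_integrable (hH.integrable_comp hs')
  have i4 : Integrable (fun x => (φ (x + -c * (s - t)) - φ x
      - (-c * (s - t)) * deriv φ x) * H (W s x)) := by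
    refine ((i3.sub i1).sub i2).congr (Eventually.of_forall fun x => ?_)
    simp only [Pi.sub_apply]
    ring
  simp only [Pi.add_apply]
  rw [e1, ← integral_const_mul, ← integral_add_add i1 i2 i4]
  refine integral_congr_ae (Eventually.of_forall fun x => ?_)
  simp only
  ring

lemma quadraticBound_sq : QuadraticBound (fun y => y ^ 2) (fun y => 2 * y) Set.univ 2 where
  continuous := by fun_prop
  continuous_deriv := by fun_prop
  nonneg := by norm_num
  taylor y _ z _ := by
    rw [show z ^ 2 - y ^ 2 - 2 * y * (z - y) = (z - y) ^ 2 by ring, abs_of_nonneg (sq_nonneg _)]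
    nlinarith [sq_nonneg (z - y)]
  bound y _ := by
    rw [abs_of_nonneg (sq_nonneg _)]
    nlinarith [sq_nonneg y]
  bound_deriv y _ := by simp [abs_mul]

lemma IsTransport.add {c : ℝ} {a g b k : ℝ → L2} (ha : IsTransport c a g)
    (hb : IsTransport c b k) :
    IsTransport c (fun t => a t + b t) (fun t => g t + k t) where
  continuous := ha.continuous.add hb.continuous
  continuous_source := ha.continuous_source.add hb.continuous_source
  weak φ hφ t := by
    have hsplit : ∀ (f f' : L2) {ψ : ℝ → ℝ} (_ : IsTest ψ),
        ∫ x, (f + f' : L2) x * ψ x = (∫ x, f x * ψ x) + ∫ x, f' x * ψ x := by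
      intro f f' ψ hψ
      rw [← inner_testLp _ hψ, ← inner_testLp _ hψ, ← inner_testLp _ hψ, inner_add_left]
    simp only [hsplit _ _ hφ, hsplit _ _ hφ.deriv]
    exact ((ha.weak φ hφ t).add (hb.weak φ hφ t)).congr_deriv (by ring)

/-- The polarised form of the functional `∫ φ a²`. -/
lemma IsTransport.hasDerivAt_integral_mul {c : ℝ} {a g b k : ℝ → L2} (ha : IsTransport c a g)
    (hb : IsTransport c b k) {φ : ℝ → ℝ} (hφ : IsTest φ) (t : ℝ) :
    HasDerivAt (fun s => ∫ x, φ x * (a s x * b s x))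
      (-c * (∫ x, deriv φ x * (a t x * b t x)) +
        ∫ x, φ x * (g t x * b t x + a t x * k t x)) t := by
  have key : ∀ {a g : ℝ → L2} (_ : IsTransport c a g),
      HasDerivAt (fun s => ∫ x, φ x * a s x ^ 2)
      (-c * (∫ x, deriv φ x * a t x ^ 2) + ∫ x, φ x * (2 * a t x * g t x)) t :=
    fun h => h.hasDerivAt_integral_comp quadraticBound_sq (by simp) hφ
  have hpol : ∀ (f f' : L2) {ψ : ℝ → ℝ} (_ : IsTest ψ),
      ∫ x, ψ x * (f x * f' x) = ((∫ x, ψ x * (f + f' : L2) x ^ 2) - (∫ x, ψ x * f x ^ 2)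
        - ∫ x, ψ x * f' x ^ 2) / 2 := by
    intro f f' ψ hψ
    have i : ∀ f : L2, Integrable fun x => ψ x * f x ^ 2 := fun f =>
      hψ.integrable_mul_of_integrable (integrable_sq f)
    rw [← integral_sub_sub (i _) (i _) (i _), ← integral_div]
    refine integral_congr_ae ?_
    filter_upwards [Lp.coeFn_add f f'] with x hx
    rw [hx, Pi.add_apply]
    ring
  have hsum := (((key (ha.add hb)).sub (key ha)).sub (key hb)).div_const 2
  refine (hsum.congr_of_eventuallyEq (Eventually.of_forall fun s => hpol _ _ hφ)).congr_deriv ?_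
  rw [hpol _ _ hφ.deriv]
  have e : ∫ x, φ x * (g t x * b t x + a t x * k t x) =
      ((∫ x, φ x * (2 * (a t + b t : L2) x * (g t + k t : L2) x))
        - (∫ x, φ x * (2 * a t x * g t x)) - ∫ x, φ x * (2 * b t x * k t x)) / 2 := by
    have i : ∀ f f' : L2, Integrable fun x => φ x * (2 * f x * f' x) := fun f f' =>
      hφ.integrable_mul_of_integrable 
        (by simpa only [mul_assoc] using (integrable_mul f f').const_mul 2)
    rw [← integral_sub_sub (i _ _) (i _ _) (i _ _), ← integral_div]
    refine integral_congr_ae ?_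
    filter_upwards [Lp.coeFn_add (a t) (b t), Lp.coeFn_add (g t) (k t)] with x hx hx'
    rw [hx, hx', Pi.add_apply, Pi.add_apply]
    ring
  rw [e]
  ring

/-- An element of `H¹` is a stationary solution of a transport equation. -/
lemma HasWeakDeriv.isTransport {f f' : L2} (h : HasWeakDeriv f f') :
    IsTransport 1 (fun _ => f) (fun _ => -f') where
  continuous := continuous_const
  continuous_source := continuous_const
  weak φ hφ t := by
    have hneg : ∫ x, (-f' : L2) x * φ x = - ∫ x, f' x * φ x := by
      rw [← inner_testLp _ hφ, ← inner_testLp _ hφ, inner_neg_left]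
    rw [hneg, h φ hφ]
    simpa using hasDerivAt_const t (∫ x, f x * φ x)

/-- The chain rule `(H(f))' = h(f) f'` in the sense of distributions, for `f ∈ H¹`. -/
lemma HasWeakDeriv.integral_deriv_mul_comp {f f' : L2} (hw : HasWeakDeriv f f')
    {H h : ℝ → ℝ} {S : Set ℝ} {K : ℝ} (hH : QuadraticBound H h S K)
    (hS : ∀ᵐ x : ℝ, f x ∈ S) {φ : ℝ → ℝ} (hφ : IsTest φ) :
    ∫ x, deriv φ x * H (f x) = - ∫ x, φ x * (h (f x) * f' x) := by
  have h1 := (hw.isTransport.hasDerivAt_integral_comp hH (t := 0)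
    (Eventually.of_forall fun _ => hS) hφ).unique (hasDerivAt_const _ _)
  have e : ∫ x, φ x * (h (f x) * (-f' : L2) x) = - ∫ x, φ x * (h (f x) * f' x) := by
    rw [← integral_neg]
    refine integral_congr_ae ?_
    filter_upwards [Lp.coeFn_neg f'] with x hx
    rw [hx, Pi.neg_apply]
    ring
  rw [e] at h1
  linarith

/-! ### Cutoff functions -/

/-- The smooth bump function equal to `1` on `[-1, 1]` and supported in `[-2, 2]`. -/
noncomputable def bump : ContDiffBump (0 : ℝ) := ⟨1, 2, one_pos, one_lt_two⟩

/-- A smooth cutoff function: `1` on `[-1, 1]`, supported in `[-2, 2]`, with values in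
`[0, 1]`. -/
noncomputable def cutoff (x : ℝ) : ℝ := bump x

lemma isTest_cutoff : IsTest cutoff := ⟨bump.contDiff, bump.hasCompactSupport⟩

lemma cutoff_nonneg (x : ℝ) : 0 ≤ cutoff x := bump.nonneg

lemma cutoff_le_one (x : ℝ) : cutoff x ≤ 1 := bump.le_one

lemma abs_cutoff_le_one (x : ℝ) : |cutoff x| ≤ 1 := by
  rw [abs_of_nonneg (cutoff_nonneg x)]
  exact cutoff_le_one x

lemma cutoff_eq_one {x : ℝ} (h : |x| ≤ 1) : cutoff x = 1 :=
  bump.one_of_mem_closedBall (by simpa [bump] using h)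

lemma cutoff_eq_zero {x : ℝ} (h : 2 ≤ |x|) : cutoff x = 0 :=
  bump.zero_of_le_dist (by simpa [bump] using h)

lemma IsTest.comp_div {φ : ℝ → ℝ} (h : IsTest φ) {R : ℝ} (hR : 0 < R) :
    IsTest (fun x => φ (x / R)) := by
  refine ⟨h.1.comp (contDiff_id.div_const R), ?_⟩
  have := h.2.comp_homeomorph (Homeomorph.mulRight₀ R⁻¹ (inv_ne_zero hR.ne'))
  simpa [Function.comp_def, div_eq_mul_inv] using this

lemma IsTest.deriv_comp_div {φ : ℝ → ℝ} (h : IsTest φ) (R x : ℝ) :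
    _root_.deriv (fun x => φ (x / R)) x = _root_.deriv φ (x / R) / R := by
  have h2 : HasDerivAt (fun x : ℝ => x / R) (1 / R) x := (hasDerivAt_id x).div_const R
  have h1 := (HasDerivAt.comp (h₂ := φ) x (h.hasDerivAt (x / R)) h2).deriv
  simpa [Function.comp_def, div_eq_mul_inv] using h1

/-- The truncated identity function `x ↦ x` on `[-1, 1]`, supported in `[-2, 2]`. -/
noncomputable def cutoffId (x : ℝ) : ℝ := x * cutoff x

lemma isTest_cutoffId : IsTest cutoffId := isTest_cutoff.mul contDiff_id

lemma cutoffId_of_abs_le {x : ℝ} (h : |x| ≤ 1) : cutoffId x = x := by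
  rw [cutoffId, cutoff_eq_one h, mul_one]

lemma abs_cutoffId_le (x : ℝ) : |cutoffId x| ≤ 2 := by
  rcases le_or_gt 2 |x| with h | h
  · simp [cutoffId, cutoff_eq_zero h]
  · rw [cutoffId, abs_mul]
    nlinarith [abs_cutoff_le_one x, abs_nonneg x, abs_nonneg (cutoff x)]

lemma deriv_cutoffId {x : ℝ} (h : |x| < 1) : deriv cutoffId x = 1 := by
  have : cutoffId =ᶠ[𝓝 x] id := by
    filter_upwards [continuous_abs.continuousAt.eventually_lt_const h] with y hy
    exact cutoffId_of_abs_le hy.le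
  rw [this.deriv_eq, deriv_id]

lemma deriv_deriv_cutoffId {x : ℝ} (h : |x| < 1) : deriv (deriv cutoffId) x = 0 := by
  have : deriv cutoffId =ᶠ[𝓝 x] fun _ => 1 := by
    filter_upwards [continuous_abs.continuousAt.eventually_lt_const h] with y hy
    exact deriv_cutoffId hy
  rw [this.deriv_eq, deriv_const]

lemma tendsto_integral_cutoff_mul {F : ℝ → ℝ} (hF : Integrable F) :
    Tendsto (fun R : ℝ => ∫ x, cutoff (x / R) * F x) atTop (𝓝 (∫ x, F x)) := by
  refine tendsto_integral_filter_of_dominated_convergence (fun x => |F x|) ?_ ?_ hF.abs ?_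
  · exact Eventually.of_forall fun R => (isTest_cutoff.continuous.comp
      (continuous_id.div_const R)).aestronglyMeasurable.mul hF.1
  · refine Eventually.of_forall fun R => Eventually.of_forall fun x => ?_
    rw [Real.norm_eq_abs, abs_mul]
    exact mul_le_of_le_one_left (abs_nonneg _) (abs_cutoff_le_one _)
  · refine Eventually.of_forall fun x => ?_
    refine tendsto_const_nhds.congr' ?_
    filter_upwards [eventually_ge_atTop |x|, eventually_gt_atTop 0] with R hR hR0
    rw [cutoff_eq_one, one_mul]
    rw [abs_div, abs_of_pos hR0]
    exact (div_le_one hR0).2 hR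

lemma abs_integral_mul_le_of_abs_le {ψ F : ℝ → ℝ} {B : ℝ} (hF : Integrable F)
    (hB : ∀ x, |ψ x| ≤ B) : |∫ x, ψ x * F x| ≤ B * ∫ x, |F x| := by
  rw [← integral_const_mul]
  refine norm_integral_le_of_norm_le (f := fun x => ψ x * F x) (hF.abs.const_mul B)
    (Eventually.of_forall fun x => ?_)
  rw [Real.norm_eq_abs, abs_mul]
  exact mul_le_mul_of_nonneg_right (hB x) (abs_nonneg _)

lemma integral_abs_mul_le (f g : L2) : ∫ x, |f x * g x| ≤ ‖f‖ * ‖g‖ := by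
  have h := abs_integral_mul_le ((Lp.memLp f).norm.toLp _) ((Lp.memLp g).norm.toLp _)
  rw [Lp.norm_toLp, Lp.norm_toLp, eLpNorm_norm, eLpNorm_norm, ← Lp.norm_def, ← Lp.norm_def] at h
  refine le_trans (le_of_eq ?_) ((le_abs_self _).trans h)
  refine integral_congr_ae ?_
  filter_upwards [(Lp.memLp f).norm.coeFn_toLp, (Lp.memLp g).norm.coeFn_toLp] with x h1 h2
  rw [h1, h2, abs_mul, Real.norm_eq_abs, Real.norm_eq_abs]

/-- A density whose weighted integrals obey a local conservation law has a conserved total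
integral. -/
lemma integral_eq_of_local_conservation {F J : ℝ → ℝ → ℝ} {b : ℝ → ℝ}
    (hF : ∀ t, Integrable (F t)) (hJ : ∀ t, Integrable (J t)) (hb : Continuous b)
    (hJb : ∀ t, ∫ x, |J t x| ≤ b t)
    (hd : ∀ φ : ℝ → ℝ, IsTest φ → ∀ t,
      HasDerivAt (fun s => ∫ x, φ x * F s x) (-∫ x, deriv φ x * J t x) t) (t : ℝ) :
    ∫ x, F t x = ∫ x, F 0 x := by
  obtain ⟨K, hK0, hK⟩ := isTest_cutoff.deriv.exists_bound
  obtain ⟨B, hB⟩ := (isCompact_uIcc (a := 0) (b := t)).exists_bound_of_continuousOn hb.continuousOn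
  have hbound : ∀ᶠ R : ℝ in atTop,
      |(∫ x, cutoff (x / R) * F t x) - ∫ x, cutoff (x / R) * F 0 x| ≤ K / R * B * |t - 0| := by
    filter_upwards [eventually_gt_atTop 0] with R hR
    refine Convex.norm_image_sub_le_of_norm_hasDerivWithin_le
      (f := fun s => ∫ x, cutoff (x / R) * F s x) (s := Set.uIcc 0 t)
      (fun s _ => (hd _ (isTest_cutoff.comp_div hR) s).hasDerivWithinAt) (fun s hs => ?_)
      (convex_uIcc _ _) Set.left_mem_uIcc Set.right_mem_uIcc
    rw [norm_neg, Real.norm_eq_abs]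
    refine (abs_integral_mul_le_of_abs_le (B := K / R) (hJ s) fun x => ?_).trans ?_
    · rw [isTest_cutoff.deriv_comp_div, abs_div, abs_of_pos hR]
      gcongr
      exact hK _
    · have h1 : ∫ x, |J s x| ≤ B :=
        (hJb s).trans ((le_abs_self _).trans (hB s hs))
      gcongr
  have hlim : Tendsto (fun R : ℝ => K / R * B * |t - 0|) atTop (𝓝 0) := by
    have : Tendsto (fun R : ℝ => K / R) atTop (𝓝 0) := tendsto_const_nhds.div_atTop tendsto_id
    simpa using (this.mul_const B).mul_const |t - 0|
  have hl := ((tendsto_integral_cutoff_mul (hF t)).sub (tendsto_integral_cutoff_mul (hF 0))).abs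
  have := le_of_tendsto_of_tendsto hl hlim hbound
  exact sub_eq_zero.1 (abs_nonpos_iff.1 this)

/-! ### The embedding of `H¹` into `L^∞` -/

/-- Weighted form of `sup f² ≤ 2 ‖f‖ ‖f'‖`. -/
lemma HasWeakDeriv.integral_mul_sq_le {f f' : L2} (hw : HasWeakDeriv f f') {ψ : ℝ → ℝ}
    (hψ : IsTest ψ) (h0 : ∀ x, 0 ≤ ψ x) :
    ∫ x, ψ x * f x ^ 2 ≤ (2 * ‖f‖ * ‖f'‖) * ∫ x, ψ x := by
  have hψi : Integrable ψ := hψ.continuous.integrable_of_hasCompactSupport hψ.2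
  set I := ∫ x, ψ x with hI
  have hI0 : 0 ≤ I := integral_nonneg h0
  -- The chain rule for `f²` is tested with a truncated primitive of `ψ`, which is at most `∫ ψ`.
  set Ψ : ℝ → ℝ := fun x => ∫ y in (0 : ℝ)..x, ψ y with hΨ
  have hΨd : ∀ x, HasDerivAt Ψ (ψ x) x := fun x =>
    (hψ.continuous.integral_hasStrictDerivAt 0 x).hasDerivAt
  have hΨderiv : deriv Ψ = ψ := funext fun x => (hΨd x).deriv
  have hΨs : ContDiff ℝ ∞ Ψ := by
    rw [contDiff_infty_iff_deriv, hΨderiv]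
    exact ⟨fun x => (hΨd x).differentiableAt, hψ.1⟩
  have hΨb : ∀ x, |Ψ x| ≤ I := by
    intro x
    refine (intervalIntegral.norm_integral_le_integral_norm_uIoc (f := ψ)).trans ?_
    simp only [Real.norm_eq_abs, abs_of_nonneg (h0 _)]
    exact setIntegral_le_integral hψi (Eventually.of_forall h0)
  obtain ⟨K, hK0, hK⟩ := isTest_cutoff.deriv.exists_bound
  have hkey : ∀ R : ℝ, 0 < R → ∫ x, cutoff (x / R) * (ψ x * f x ^ 2)
      ≤ (2 * ‖f‖ * ‖f'‖) * I + I * K / R * ‖f‖ ^ 2 := by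
    intro R hR
    have hT := (isTest_cutoff.comp_div hR).mul hΨs
    have h1 := hw.integral_deriv_mul_comp quadraticBound_sq (by simp) hT
    have hder : ∀ x, deriv (fun x => Ψ x * cutoff (x / R)) x
        = cutoff (x / R) * ψ x + Ψ x * (deriv cutoff (x / R) / R) := by
      intro x
      rw [← isTest_cutoff.deriv_comp_div, mul_comm (cutoff _)]
      exact ((hΨd x).mul ((isTest_cutoff.comp_div hR).hasDerivAt x)).deriv
    have i1 : Integrable (fun x => cutoff (x / R) * (ψ x * f x ^ 2)) :=
      (isTest_cutoff.comp_div hR).integrable_mul_of_integrable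
        (hψ.integrable_mul_of_integrable (integrable_sq f))
    have hbd : ∀ x, |Ψ x * (deriv cutoff (x / R) / R)| ≤ I * K / R := by
      intro x
      rw [abs_mul, abs_div, abs_of_pos hR, mul_div_assoc]
      have := hΨb x
      have := hK (x / R)
      gcongr
    have i2 : Integrable (fun x => Ψ x * (deriv cutoff (x / R) / R) * f x ^ 2) := by
      refine (integrable_sq f).bdd_mul (Continuous.aestronglyMeasurable ?_)
        (Eventually.of_forall hbd)
      exact hΨs.continuous.mul ((isTest_cutoff.deriv.continuous.comp
        (continuous_id.div_const R)).div_const R)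
    have e1 : ∫ x, deriv (fun x => Ψ x * cutoff (x / R)) x * f x ^ 2
        = (∫ x, cutoff (x / R) * (ψ x * f x ^ 2))
          + ∫ x, Ψ x * (deriv cutoff (x / R) / R) * f x ^ 2 := by
      rw [← integral_add i1 i2]
      refine integral_congr_ae (Eventually.of_forall fun x => ?_)
      simp only [hder]
      ring
    have b1 : |∫ x, Ψ x * (deriv cutoff (x / R) / R) * f x ^ 2| ≤ I * K / R * ‖f‖ ^ 2 := by
      rw [← integral_sq_eq]
      have := abs_integral_mul_le_of_abs_le (integrable_sq f) hbd
      simpa only [abs_pow, sq_abs] using this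
    have b2 : |∫ x, Ψ x * cutoff (x / R) * (2 * f x * f' x)| ≤ I * (2 * (‖f‖ * ‖f'‖)) := by
      have hi : Integrable (fun x => 2 * f x * f' x) := by
        simpa only [mul_assoc] using (integrable_mul f f').const_mul 2
      refine (abs_integral_mul_le_of_abs_le (B := I) hi fun x => ?_).trans ?_
      · rw [abs_mul]
        nlinarith [hΨb x, abs_cutoff_le_one (x / R), abs_nonneg (Ψ x),
          abs_nonneg (cutoff (x / R))]
      · simp only [mul_assoc, abs_mul (2 : ℝ), abs_two]
        rw [integral_const_mul]
        have := integral_abs_mul_le f f'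
        gcongr
    rw [e1] at h1
    have h2 := (abs_le.1 b1).1
    have h3 := (abs_le.1 b2).1
    linarith
  have hlim := tendsto_integral_cutoff_mul (hψ.integrable_mul_of_integrable (integrable_sq f))
  have hlim2 : Tendsto (fun R : ℝ => (2 * ‖f‖ * ‖f'‖) * I + I * K / R * ‖f‖ ^ 2) atTop
      (𝓝 ((2 * ‖f‖ * ‖f'‖) * I)) := by
    have : Tendsto (fun R : ℝ => I * K / R) atTop (𝓝 0) := tendsto_const_nhds.div_atTop tendsto_id
    simpa using (this.mul_const (‖f‖ ^ 2)).const_add ((2 * ‖f‖ * ‖f'‖) * I)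
  refine le_of_tendsto_of_tendsto hlim hlim2 ?_
  filter_upwards [eventually_gt_atTop 0] with R hR using hkey R hR

lemma HasWeakDeriv.ae_sq_le {f f' : L2} (hw : HasWeakDeriv f f') :
    ∀ᵐ x : ℝ, f x ^ 2 ≤ 2 * ‖f‖ * ‖f'‖ := by
  set K := 2 * ‖f‖ * ‖f'‖
  -- Average against an approximate identity.
  set b : ℕ → ContDiffBump (0 : ℝ) := fun n =>
    ⟨1 / (n + 1 : ℝ), 2 * (1 / (n + 1 : ℝ)), by positivity, by
      have : (0 : ℝ) < 1 / (n + 1) := by positivity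
      linarith⟩ with hb
  have hloc : LocallyIntegrable (fun x => K - f x ^ 2) volume :=
    (locallyIntegrable_const K).sub (integrable_sq f).locallyIntegrable
  have hlim := ContDiffBump.ae_convolution_tendsto_right_of_locallyIntegrable (K := 2)
    (φ := b) (l := atTop) (μ := volume)
    (by simpa [hb] using (tendsto_one_div_add_atTop_nhds_zero_nat (𝕜 := ℝ)).const_mul 2)
    (Eventually.of_forall fun n => le_rfl) hloc
  filter_upwards [hlim] with x hx
  have h0 : 0 ≤ K - f x ^ 2 := by
    refine ge_of_tendsto hx (Eventually.of_forall fun n => ?_)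
    have hnT : IsTest ((b n).normed volume) :=
      ⟨(b n).contDiff_normed, (b n).hasCompactSupport_normed⟩
    have hT : IsTest (fun y => (b n).normed volume (x - y)) :=
      ⟨hnT.1.comp (contDiff_const.sub contDiff_id),
        hnT.2.comp_homeomorph (Homeomorph.subLeft x)⟩
    have h1 := hw.integral_mul_sq_le hT (fun y => (b n).nonneg_normed _)
    have e : convolution ((b n).normed volume) (fun y => K - f y ^ 2)
        (ContinuousLinearMap.lsmul ℝ ℝ) volume x
        = K * (∫ y, (b n).normed volume (x - y)) - ∫ y, (b n).normed volume (x - y) * f y ^ 2 := by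
      rw [convolution_eq_swap, ← integral_const_mul, ← integral_sub]
      · refine integral_congr_ae (Eventually.of_forall fun y => ?_)
        simp only [ContinuousLinearMap.lsmul_apply, smul_eq_mul]
        ring
      · exact (hT.continuous.integrable_of_hasCompactSupport hT.2).const_mul _
      · exact hT.integrable_mul_of_integrable (integrable_sq f)
    rw [e]
    linarith
  linarith

/-! ### The nonlinearity -/

/-- The full restoring force `y + 𝒩(y)`. -/
noncomputable def force (y : ℝ) : ℝ := y + nonlin y

/-- The potential energy density: the primitive of `force` vanishing at `0`. -/
noncomputable def potential (y : ℝ) : ℝ := (Real.exp (y ^ 2) - 1 - y ^ 4 / 2) / 2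

lemma force_eq (y : ℝ) : force y = y * Real.exp (y ^ 2) - y ^ 3 := by
  rw [force, nonlin]
  ring

lemma hasDerivAt_potential (y : ℝ) : HasDerivAt potential (force y) y := by
  have h1 : HasDerivAt (fun y : ℝ => Real.exp (y ^ 2)) (Real.exp (y ^ 2) * (2 * y)) y := by
    simpa using (hasDerivAt_pow 2 y).exp
  have h2 : HasDerivAt (fun y : ℝ => y ^ 4) (4 * y ^ 3) y := by simpa using hasDerivAt_pow 4 y
  refine (((h1.sub_const 1).sub (h2.div_const 2)).div_const 2).congr_deriv ?_
  rw [force_eq]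
  ring

lemma hasDerivAt_force (y : ℝ) :
    HasDerivAt force (Real.exp (y ^ 2) + 2 * y ^ 2 * Real.exp (y ^ 2) - 3 * y ^ 2) y := by
  have h1 : HasDerivAt (fun y : ℝ => Real.exp (y ^ 2)) (Real.exp (y ^ 2) * (2 * y)) y := by
    simpa using (hasDerivAt_pow 2 y).exp
  have h2 : HasDerivAt (fun y : ℝ => y ^ 3) (3 * y ^ 2) y := by simpa using hasDerivAt_pow 3 y
  have h3 := ((hasDerivAt_id y).mul h1).sub h2
  have e : force = (id * fun y : ℝ => Real.exp (y ^ 2)) - fun y : ℝ => y ^ 3 := by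
    funext z
    simp [force_eq]
  rw [e]
  refine h3.congr_deriv ?_
  simp only [id]
  ring

lemma sq_div_two_le_potential (y : ℝ) : y ^ 2 / 2 ≤ potential y := by
  have h := Real.quadratic_le_exp_of_nonneg (sq_nonneg y)
  rw [potential]
  nlinarith

/-- The virial inequality `2 (y²/2 + F(y)) ≤ y (y + 𝒩(y))`: this is where the nonlinearity is
defocusing and superquadratic. -/
lemma two_mul_potential_le (y : ℝ) : 2 * potential y ≤ y * force y := by
  have key : ∀ z : ℝ, 0 ≤ z → 0 ≤ (z - 1) * Real.exp z + 1 - z ^ 2 / 2 := by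
    have hd : ∀ z : ℝ, HasDerivAt (fun z : ℝ => (z - 1) * Real.exp z + 1 - z ^ 2 / 2)
        (z * (Real.exp z - 1)) z := by
      intro z
      have h1 := (((hasDerivAt_id z).sub_const 1).mul (Real.hasDerivAt_exp z)).add_const 1
      have h2 : HasDerivAt (fun z : ℝ => z ^ 2 / 2) z z := by
        simpa using (hasDerivAt_pow 2 z).div_const 2
      refine (h1.sub h2).congr_deriv ?_
      simp only [id]
      ring
    have hmono : MonotoneOn (fun z : ℝ => (z - 1) * Real.exp z + 1 - z ^ 2 / 2) (Set.Ici 0) := by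
      refine monotoneOn_of_deriv_nonneg (convex_Ici 0)
        (fun z _ => (hd z).continuousAt.continuousWithinAt)
        (fun z _ => (hd z).differentiableAt.differentiableWithinAt) fun z hz => ?_
      rw [interior_Ici] at hz
      rw [(hd z).deriv]
      exact mul_nonneg (le_of_lt hz) (by linarith [Real.add_one_le_exp z, Set.mem_Ioi.1 hz])
    intro z hz
    have := hmono (Set.mem_Ici.2 le_rfl) (Set.mem_Ici.2 hz) hz
    simpa using this
  have := key (y ^ 2) (sq_nonneg y)
  rw [force_eq, potential]
  nlinarith

lemma potential_nonneg (y : ℝ) : 0 ≤ potential y :=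
  (by positivity : (0 : ℝ) ≤ y ^ 2 / 2).trans (sq_div_two_le_potential y)

/-- On bounded sets of values the potential and the force are `C^{1,1}`. -/
lemma exists_quadraticBound_potential (M : ℝ) :
    ∃ K, QuadraticBound potential force (Set.Icc (-M) M) K ∧
      ∀ y ∈ Set.Icc (-M) M, ∀ z ∈ Set.Icc (-M) M, |force z - force y| ≤ K * |z - y| := by
  obtain ⟨K, hK⟩ := (isCompact_Icc (a := -M) (b := M)).exists_bound_of_continuousOn
    (f := fun y : ℝ => Real.exp (y ^ 2) + 2 * y ^ 2 * Real.exp (y ^ 2) - 3 * y ^ 2) (by fun_prop)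
  have hK' : ∀ y ∈ Set.Icc (-M) M,
      ‖Real.exp (y ^ 2) + 2 * y ^ 2 * Real.exp (y ^ 2) - 3 * y ^ 2‖ ≤ |K| :=
    fun y hy => (hK y hy).trans (le_abs_self K)
  have hlip : ∀ y ∈ Set.Icc (-M) M, ∀ z ∈ Set.Icc (-M) M,
      |force z - force y| ≤ |K| * |z - y| := fun y hy z hz =>
    Convex.norm_image_sub_le_of_norm_hasDerivWithin_le
      (fun w _ => (hasDerivAt_force w).hasDerivWithinAt) hK' (convex_Icc _ _) hy hz
  have htaylor : ∀ y ∈ Set.Icc (-M) M, ∀ z ∈ Set.Icc (-M) M,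
      |potential z - potential y - force y * (z - y)| ≤ |K| * (z - y) ^ 2 := by
    intro y hy z hz
    have hsub : Set.uIcc y z ⊆ Set.Icc (-M) M := Set.uIcc_subset_Icc hy hz
    have key := Convex.norm_image_sub_le_of_norm_hasDerivWithin_le
      (f := fun w => potential w - w * force y) (s := Set.uIcc y z)
      (f' := fun w => force w - force y) (C := |K| * |z - y|) (x := y) (y := z)
      (fun w _ => by
        have := (hasDerivAt_potential w).sub ((hasDerivAt_id w).mul_const (force y))
        rw [one_mul] at this
        exact this.hasDerivWithinAt)
      (fun w hw => (hlip y hy w (hsub hw)).trans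
        (mul_le_mul_of_nonneg_left (Set.abs_sub_left_of_mem_uIcc hw) (abs_nonneg _)))
      (convex_uIcc _ _) Set.left_mem_uIcc Set.right_mem_uIcc
    have e : (potential z - z * force y) - (potential y - y * force y)
      = potential z - potential y - force y * (z - y) := by ring
    simp only [Real.norm_eq_abs] at key
    rw [e] at key
    calc _ ≤ |K| * |z - y| * |z - y| := key
      _ = |K| * (z - y) ^ 2 := by rw [mul_assoc, ← sq, sq_abs]
  have h0 : ∀ y ∈ Set.Icc (-M) M, (0 : ℝ) ∈ Set.Icc (-M) M := by
    intro y hy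
    have := hy.1.trans hy.2
    constructor <;> linarith
  refine ⟨|K|, ⟨?_, ?_, abs_nonneg K, htaylor, fun y hy => ?_, fun y hy => ?_⟩, hlip⟩
  · exact continuous_iff_continuousAt.2 fun y => (hasDerivAt_potential y).continuousAt
  · exact continuous_iff_continuousAt.2 fun y => (hasDerivAt_force y).continuousAt
  · simpa [potential, force_eq] using htaylor 0 (h0 y hy) y hy
  · simpa [force_eq] using hlip 0 (h0 y hy) y hy

/-! ### Weighted `L²` pairings -/

/-- The weighted pairing `∫ ψ f g`. -/
noncomputable def pairing (ψ : ℝ → ℝ) (f g : L2) : ℝ := ∫ x, ψ x * (f x * g x)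

section pairing

variable {ψ : ℝ → ℝ} (hψ : IsTest ψ) (f f' g : L2)

lemma pairing_comm (ψ : ℝ → ℝ) (f g : L2) : pairing ψ f g = pairing ψ g f := by
  simp only [pairing, mul_comm]

include hψ in
lemma pairing_add_left : pairing ψ (f + f') g = pairing ψ f g + pairing ψ f' g := by
  rw [pairing, pairing, pairing,
    ← integral_add (hψ.integrable_mul_of_integrable (integrable_mul f g))
    (hψ.integrable_mul_of_integrable (integrable_mul f' g))]
  refine integral_congr_ae ?_
  filter_upwards [Lp.coeFn_add f f'] with x hx
  rw [hx, Pi.add_apply]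
  ring

include hψ in
lemma pairing_sub_left : pairing ψ (f - f') g = pairing ψ f g - pairing ψ f' g := by
  rw [eq_sub_iff_add_eq, ← pairing_add_left hψ, sub_add_cancel]

include hψ in
lemma pairing_add_right : pairing ψ g (f + f') = pairing ψ g f + pairing ψ g f' := by
  simp only [pairing_comm ψ g, pairing_add_left hψ]

include hψ in
lemma pairing_sub_right : pairing ψ g (f - f') = pairing ψ g f - pairing ψ g f' := by
  simp only [pairing_comm ψ g, pairing_sub_left hψ]

end pairing

lemma IsTransport.hasDerivAt_pairing {c : ℝ} {a g b k : ℝ → L2} (ha : IsTransport c a g)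
    (hb : IsTransport c b k) {φ : ℝ → ℝ} (hφ : IsTest φ) (t : ℝ) :
    HasDerivAt (fun s => pairing φ (a s) (b s))
      (-c * pairing (deriv φ) (a t) (b t) + pairing φ (g t) (b t) + pairing φ (a t) (k t)) t := by
  refine (ha.hasDerivAt_integral_mul hb hφ t).congr_deriv ?_
  rw [add_assoc, pairing, pairing, pairing, ← integral_add
    (hφ.integrable_mul_of_integrable (integrable_mul _ _))
    (hφ.integrable_mul_of_integrable (integrable_mul _ _))]
  simp only [mul_add]

/-! ### Local conservation laws -/

/-- The energy density of the state `(f, k)`, where `g` is the space derivative of `f`. -/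
noncomputable def energyDensity (f g k : L2) (x : ℝ) : ℝ :=
  (k x ^ 2 + g x ^ 2) / 2 + potential (f x)

/-- The flux of momentum. -/
noncomputable def stressDensity (f g k : L2) (x : ℝ) : ℝ :=
  (k x ^ 2 + g x ^ 2) / 2 - potential (f x)

namespace IsGlobalSolution

variable {u ux ut : ℝ → L2} (h : IsGlobalSolution u ux ut)
include h

lemma continuous_u : Continuous u :=
  continuous_iff_continuousAt.2 fun t => (h.hasDerivAt t).continuousAt

lemma eventually_bounded (t : ℝ) :
    ∃ M, ∀ᶠ s in 𝓝 t, ∀ᵐ x : ℝ, u s x ∈ Set.Icc (-M) M := by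
  refine ⟨√(2 * (‖u t‖ + 1) * (‖ux t‖ + 1)), ?_⟩
  filter_upwards [h.continuous_u.continuousAt.norm.eventually_lt_const
      (show ‖u t‖ < ‖u t‖ + 1 by simp),
    h.continuous_ux.continuousAt.norm.eventually_lt_const
      (show ‖ux t‖ < ‖ux t‖ + 1 by simp)] with s h1 h2
  filter_upwards [(h.weakDeriv s).ae_sq_le] with x hx
  refine abs_le.1 (Real.abs_le_sqrt (hx.trans ?_))
  gcongr

lemma exists_quadraticBound (t : ℝ) : ∃ S K, QuadraticBound potential force S K ∧
    (∀ y ∈ S, ∀ z ∈ S, |force z - force y| ≤ K * |z - y|) ∧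
    ∀ᶠ s in 𝓝 t, ∀ᵐ x : ℝ, u s x ∈ S := by
  obtain ⟨M, hM⟩ := h.eventually_bounded t
  obtain ⟨K, hK, hl⟩ := exists_quadraticBound_potential M
  exact ⟨_, K, hK, hl, hM⟩

lemma memLp_force (t : ℝ) : MemLp (fun x => force (u t x)) 2 (volume : Measure ℝ) := by
  obtain ⟨S, K, hK, -, hS⟩ := h.exists_quadraticBound t
  exact hK.memLp_deriv_comp hS.self_of_nhds

lemma integrable_potential (t : ℝ) : Integrable (fun x => potential (u t x)) := by
  obtain ⟨S, K, hK, -, hS⟩ := h.exists_quadraticBound t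
  exact hK.integrable_comp hS.self_of_nhds

/-- The right hand side `-(u + 𝒩(u))` of the wave equation, as an element of `L²`. -/
noncomputable def source (t : ℝ) : L2 := -(h.memLp_force t).toLp _

lemma coeFn_source (t : ℝ) : h.source t =ᵐ[volume] fun x => - force (u t x) := by
  filter_upwards [Lp.coeFn_neg ((h.memLp_force t).toLp _), (h.memLp_force t).coeFn_toLp]
    with x h1 h2
  rw [source, h1, Pi.neg_apply, h2]

lemma continuous_source : Continuous h.source := by
  refine continuous_iff_continuousAt.2 fun t => ?_
  obtain ⟨S, K, hK, hl, hS⟩ := h.exists_quadraticBound t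
  have hSt := hS.self_of_nhds
  rw [ContinuousAt, tendsto_iff_norm_sub_tendsto_zero]
  have h0 : Tendsto (fun s => K * ‖u s - u t‖) (𝓝 t) (𝓝 0) := by
    have := tendsto_iff_norm_sub_tendsto_zero.1 (h.continuous_u.tendsto t)
    simpa using this.const_mul K
  refine squeeze_zero' (Eventually.of_forall fun _ => norm_nonneg _) ?_ h0
  filter_upwards [hS] with s hs
  refine Lp.norm_le_mul_norm_of_ae_le_mul ?_
  filter_upwards [hs, hSt, h.coeFn_source s, h.coeFn_source t,
    Lp.coeFn_sub (h.source s) (h.source t), Lp.coeFn_sub (u s) (u t)] with x h1 h2 h3 h4 h5 h6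
  rw [h5, h6, Pi.sub_apply, Pi.sub_apply, h3, h4]
  have := hl _ h2 _ h1
  rw [show -force (u s x) - -force (u t x) = -(force (u s x) - force (u t x)) by ring, norm_neg]
  exact this

lemma hasDerivAt_integral_u {φ : ℝ → ℝ} (hφ : IsTest φ) (t : ℝ) :
    HasDerivAt (fun s => ∫ x, u s x * φ x) (∫ x, ut t x * φ x) t := by
  have := (innerSL ℝ (testLp hφ)).hasFDerivAt.comp_hasDerivAt t (h.hasDerivAt t)
  simpa [Function.comp_def, real_inner_comm, inner_testLp] using this

lemma hasDerivAt_integral_ux {φ : ℝ → ℝ} (hφ : IsTest φ) (t : ℝ) :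
    HasDerivAt (fun s => ∫ x, ux s x * φ x) (-∫ x, ut t x * deriv φ x) t := by
  refine (h.hasDerivAt_integral_u hφ.deriv t).neg.congr_of_eventuallyEq
    (Eventually.of_forall fun s => ?_)
  simp [h.weakDeriv s φ hφ]

lemma hasDerivAt_integral_ut {φ : ℝ → ℝ} (hφ : IsTest φ) (t : ℝ) :
    HasDerivAt (fun s => ∫ x, ut s x * φ x)
      (-(∫ x, ux t x * deriv φ x) + ∫ x, h.source t x * φ x) t := by
  refine (h.equation φ hφ t).congr_deriv ?_
  have i1 : Integrable (fun x => u t x * φ x) := (Lp.memLp (u t)).integrable_mul hφ.memLp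
  have i2 : Integrable (fun x => force (u t x) * φ x) := (h.memLp_force t).integrable_mul hφ.memLp
  have e1 : ∫ x, nonlin (u t x) * φ x = (∫ x, force (u t x) * φ x) - ∫ x, u t x * φ x := by
    rw [← integral_sub i2 i1]
    refine integral_congr_ae (Eventually.of_forall fun x => ?_)
    simp only [force]
    ring
  have e2 : ∫ x, h.source t x * φ x = - ∫ x, force (u t x) * φ x := by
    rw [← integral_neg]
    refine integral_congr_ae ?_
    filter_upwards [h.coeFn_source t] with x hx
    rw [hx, neg_mul]
  rw [e1, e2]
  ring

/-- The null derivative `u_t + u_x` is transported to the left. -/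
lemma isTransport_add : IsTransport 1 (fun t => ut t + ux t) h.source where
  continuous := h.continuous_ut.add h.continuous_ux
  continuous_source := h.continuous_source
  weak φ hφ t := by
    have e : ∀ s {ψ : ℝ → ℝ}, IsTest ψ → ∫ x, (ut s + ux s : L2) x * ψ x
        = (∫ x, ut s x * ψ x) + ∫ x, ux s x * ψ x := by
      intro s ψ hψ
      simp only [← inner_testLp _ hψ, inner_add_left]
    simp only [e _ hφ, e _ hφ.deriv]
    exact ((h.hasDerivAt_integral_ut hφ t).add (h.hasDerivAt_integral_ux hφ t)).congr_deriv
      (by ring)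

/-- The null derivative `u_t - u_x` is transported to the right. -/
lemma isTransport_sub : IsTransport (-1) (fun t => ut t - ux t) h.source where
  continuous := h.continuous_ut.sub h.continuous_ux
  continuous_source := h.continuous_source
  weak φ hφ t := by
    have e : ∀ s {ψ : ℝ → ℝ}, IsTest ψ → ∫ x, (ut s - ux s : L2) x * ψ x
        = (∫ x, ut s x * ψ x) - ∫ x, ux s x * ψ x := by
      intro s ψ hψ
      simp only [← inner_testLp _ hψ, inner_sub_left]
    simp only [e _ hφ, e _ hφ.deriv]
    exact ((h.hasDerivAt_integral_ut hφ t).sub (h.hasDerivAt_integral_ux hφ t)).congr_deriv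
      (by ring)

/-- `u` itself solves a transport equation with any speed. -/
lemma isTransport_u (c : ℝ) : IsTransport c u (fun t => ut t - c • ux t) where
  continuous := h.continuous_u
  continuous_source := h.continuous_ut.sub (h.continuous_ux.const_smul c)
  weak φ hφ t := by
    refine (h.hasDerivAt_integral_u hφ t).congr_deriv ?_
    have e : ∫ x, (ut t - c • ux t : L2) x * φ x
        = (∫ x, ut t x * φ x) - c * ∫ x, ux t x * φ x := by
      simp only [← inner_testLp _ hφ, inner_sub_left, real_inner_smul_left]
    rw [e, h.weakDeriv t φ hφ]
    ring

lemma integrable_energyDensity (t : ℝ) : Integrable (energyDensity (u t) (ux t) (ut t)) :=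
  (((integrable_sq _).add (integrable_sq _)).div_const 2).add (h.integrable_potential t)

lemma integrable_stressDensity (t : ℝ) : Integrable (stressDensity (u t) (ux t) (ut t)) :=
  (((integrable_sq _).add (integrable_sq _)).div_const 2).sub (h.integrable_potential t)

lemma integral_mul_energyDensity {φ : ℝ → ℝ} (hφ : IsTest φ) (t : ℝ) :
    ∫ x, φ x * energyDensity (u t) (ux t) (ut t) x =
      pairing φ (ut t) (ut t) / 2 + pairing φ (ux t) (ux t) / 2
        + ∫ x, φ x * potential (u t x) := by
  rw [pairing, pairing, ← integral_div, ← integral_div, ← integral_add_add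
    ((hφ.integrable_mul_of_integrable (integrable_mul _ _)).div_const 2)
    ((hφ.integrable_mul_of_integrable (integrable_mul _ _)).div_const 2)
    (hφ.integrable_mul_of_integrable (h.integrable_potential t))]
  refine integral_congr_ae (Eventually.of_forall fun x => ?_)
  simp only [energyDensity]
  ring

lemma integral_mul_stressDensity {φ : ℝ → ℝ} (hφ : IsTest φ) (t : ℝ) :
    ∫ x, φ x * stressDensity (u t) (ux t) (ut t) x =
      pairing φ (ut t) (ut t) / 2 + pairing φ (ux t) (ux t) / 2
        - ∫ x, φ x * potential (u t x) := by
  have i3 : Integrable (fun x => -(φ x * potential (u t x))) :=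
    (hφ.integrable_mul_of_integrable (h.integrable_potential t)).neg
  rw [sub_eq_add_neg, ← integral_neg, pairing, pairing, ← integral_div, ← integral_div,
    ← integral_add_add
    ((hφ.integrable_mul_of_integrable (integrable_mul _ _)).div_const 2)
    ((hφ.integrable_mul_of_integrable (integrable_mul _ _)).div_const 2)
    i3]
  refine integral_congr_ae (Eventually.of_forall fun x => ?_)
  simp only [stressDensity]
  ring

lemma pairing_source (φ : ℝ → ℝ) (t : ℝ) (f : L2) :
    pairing φ (h.source t) f = -∫ x, φ x * (force (u t x) * f x) := by
  rw [pairing, ← integral_neg]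
  refine integral_congr_ae ?_
  filter_upwards [h.coeFn_source t] with x hx
  rw [hx]
  ring

/-- Local conservation of energy: the flux of energy is the momentum density. -/
lemma hasDerivAt_energy {φ : ℝ → ℝ} (hφ : IsTest φ) (t : ℝ) :
    HasDerivAt (fun s => ∫ x, φ x * energyDensity (u s) (ux s) (ut s) x)
      (-∫ x, deriv φ x * (ut t x * ux t x)) t := by
  obtain ⟨S, K, hK, -, hS⟩ := h.exists_quadraticBound t
  have hv := h.isTransport_add.hasDerivAt_pairing h.isTransport_add hφ t
  have hw := h.isTransport_sub.hasDerivAt_pairing h.isTransport_sub hφ t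
  have hp := (h.isTransport_u 0).hasDerivAt_integral_comp hK hS hφ
  have hsum := ((hv.add hw).div_const 4).add hp
  refine (hsum.congr_of_eventuallyEq (Eventually.of_forall fun s => ?_)).congr_deriv ?_
  · simp only [h.integral_mul_energyDensity hφ, Pi.add_apply, pairing_add_left hφ,
      pairing_add_right hφ, pairing_sub_left hφ, pairing_sub_right hφ]
    ring
  · have e : ∫ x, deriv φ x * (ut t x * ux t x) = pairing (deriv φ) (ut t) (ux t) := rfl
    rw [e]
    simp only [pairing_add_left hφ, pairing_add_right hφ, pairing_sub_left hφ,
      pairing_sub_right hφ, pairing_add_left hφ.deriv, pairing_add_right hφ.deriv,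
      pairing_sub_left hφ.deriv, pairing_sub_right hφ.deriv, pairing_comm φ _ (h.source t),
      pairing_comm (deriv φ) (ux t) (ut t), h.pairing_source, zero_smul, sub_zero]
    ring

/-- Local conservation of momentum. -/
lemma hasDerivAt_momentum {φ : ℝ → ℝ} (hφ : IsTest φ) (t : ℝ) :
    HasDerivAt (fun s => ∫ x, φ x * (ut s x * ux s x))
      (-∫ x, deriv φ x * stressDensity (u t) (ux t) (ut t) x) t := by
  obtain ⟨S, K, hK, -, hS⟩ := h.exists_quadraticBound t
  have hv := h.isTransport_add.hasDerivAt_pairing h.isTransport_add hφ t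
  have hw := h.isTransport_sub.hasDerivAt_pairing h.isTransport_sub hφ t
  have hp := (h.weakDeriv t).integral_deriv_mul_comp hK hS.self_of_nhds hφ
  have e : ∀ s, ∫ x, φ x * (ut s x * ux s x) = pairing φ (ut s) (ux s) := fun s => rfl
  refine (((hv.sub hw).div_const 4).congr_of_eventuallyEq
    (Eventually.of_forall fun s => ?_)).congr_deriv ?_
  · simp only [e, Pi.sub_apply, pairing_add_left hφ,
      pairing_add_right hφ, pairing_sub_left hφ, pairing_sub_right hφ,
      pairing_comm φ (ux s) (ut s)]
    ring
  · rw [h.integral_mul_stressDensity hφ.deriv, hp]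
    simp only [pairing_add_left hφ, pairing_add_right hφ, pairing_sub_left hφ,
      pairing_sub_right hφ, pairing_add_left hφ.deriv, pairing_add_right hφ.deriv,
      pairing_sub_left hφ.deriv, pairing_sub_right hφ.deriv, pairing_comm φ _ (h.source t),
      pairing_comm (deriv φ) (ux t) (ut t), h.pairing_source]
    ring

/-- The local form of the equipartition identity, obtained by testing the equation with `φ u`. -/
lemma hasDerivAt_integral_mul_u_ut {φ : ℝ → ℝ} (hφ : IsTest φ) (t : ℝ) :
    HasDerivAt (fun s => ∫ x, φ x * (u s x * ut s x))
      ((∫ x, φ x * (ut t x ^ 2 - ux t x ^ 2 - u t x * force (u t x)))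
        - ∫ x, deriv φ x * (u t x * ux t x)) t := by
  have hv := (h.isTransport_u 1).hasDerivAt_pairing h.isTransport_add hφ t
  have hw := (h.isTransport_u (-1)).hasDerivAt_pairing h.isTransport_sub hφ t
  have e : ∀ s, ∫ x, φ x * (u s x * ut s x) = pairing φ (u s) (ut s) := fun s => rfl
  have i3 : Integrable (fun x => u t x * force (u t x)) :=
    (Lp.memLp (u t)).integrable_mul (h.memLp_force t)
  have e2 : ∫ x, φ x * (ut t x ^ 2 - ux t x ^ 2 - u t x * force (u t x)) =
      pairing φ (ut t) (ut t) - pairing φ (ux t) (ux t) - ∫ x, φ x * (u t x * force (u t x)) := by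
    rw [pairing, pairing, ← integral_sub_sub
      (hφ.integrable_mul_of_integrable (integrable_mul _ _))
      (hφ.integrable_mul_of_integrable (integrable_mul _ _))
      (hφ.integrable_mul_of_integrable i3)]
    refine integral_congr_ae (Eventually.of_forall fun x => ?_)
    simp only
    ring
  have e3 : ∫ x, deriv φ x * (u t x * ux t x) = pairing (deriv φ) (u t) (ux t) := rfl
  have e4 : ∫ x, φ x * (u t x * force (u t x)) = ∫ x, φ x * (force (u t x) * u t x) := by
    simp only [mul_comm (force _)]
  refine (((hv.add hw).div_const 2).congr_of_eventuallyEq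
    (Eventually.of_forall fun s => ?_)).congr_deriv ?_
  · simp only [e, Pi.add_apply, pairing_add_right hφ, pairing_sub_right hφ]
    ring
  · rw [e2, e3, e4]
    simp only [one_smul, neg_smul, sub_neg_eq_add, pairing_add_left hφ, pairing_add_right hφ,
      pairing_sub_left hφ,
      pairing_sub_right hφ, pairing_add_right hφ.deriv, pairing_sub_right hφ.deriv,
      pairing_comm φ _ (h.source t), pairing_comm φ (ux t) (ut t), h.pairing_source]
    ring

end IsGlobalSolution

/-! ### Localized densities and the motion of their center -/

/-- `e` is a nonnegative density with constant total integral `E`, which is concentrated around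
the moving center `c(t)`, uniformly in time. -/
structure IsLocalized (e : ℝ → ℝ → ℝ) (c : ℝ → ℝ) (E : ℝ) : Prop where
  nonneg : ∀ t x, 0 ≤ e t x
  integrable : ∀ t, Integrable (e t)
  integral_eq : ∀ t, ∫ x, e t x = E
  tail : ∀ ε, 0 < ε → ∃ D, 0 < D ∧ ∀ t, ∫ x in {x : ℝ | D < |x - c t|}, e t x ≤ ε

lemma measurableSet_tail (D c : ℝ) : MeasurableSet {x : ℝ | D < |x - c|} :=
  measurableSet_lt measurable_const ((measurable_id.sub_const c).abs)

/-- A weight vanishing on the bulk of a localized density sees only its tail. -/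
lemma abs_integral_mul_le_tail {e J θ : ℝ → ℝ} {c D B ε : ℝ} (he0 : ∀ x, 0 ≤ e x)
    (he : Integrable e) (hJ : ∀ᵐ x : ℝ, |J x| ≤ e x) (hB : ∀ x, |θ x| ≤ B)
    (hθ : ∀ x, |x - c| ≤ D → θ x = 0) (htail : ∫ x in {x : ℝ | D < |x - c|}, e x ≤ ε) :
    |∫ x, θ x * J x| ≤ B * ε := by
  have hB0 : 0 ≤ B := (abs_nonneg _).trans (hB 0)
  refine le_trans ?_ (mul_le_mul_of_nonneg_left htail hB0)
  rw [← integral_indicator (measurableSet_tail D c), ← integral_const_mul]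
  refine norm_integral_le_of_norm_le (f := fun x => θ x * J x)
    ((he.indicator (measurableSet_tail D c)).const_mul B) ?_
  filter_upwards [hJ] with x hJx
  rw [Real.norm_eq_abs, abs_mul]
  by_cases hx : D < |x - c|
  · rw [Set.indicator_of_mem (show x ∈ {x : ℝ | D < |x - c|} from hx)]
    exact mul_le_mul (hB x) hJx (abs_nonneg _) hB0
  · rw [hθ x (not_lt.1 hx), abs_zero, zero_mul]
    exact mul_nonneg hB0 (Set.indicator_nonneg (fun y _ => he0 y) x)

lemma abs_sub_le_of_hasDerivAt {f f' : ℝ → ℝ} {B T : ℝ}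
    (hf : ∀ t, HasDerivAt f (f' t) t) (hB : ∀ t ∈ Set.Icc 0 T, |f' t| ≤ B) {t : ℝ}
    (ht : t ∈ Set.Icc 0 T) : |f t - f 0| ≤ B * t := by
  have := Convex.norm_image_sub_le_of_norm_hasDerivWithin_le (f := f) (s := Set.Icc 0 T)
    (fun s _ => (hf s).hasDerivWithinAt) hB (convex_Icc 0 T)
    (Set.left_mem_Icc.2 (ht.1.trans ht.2)) ht
  simpa [abs_of_nonneg ht.1] using this

lemma abs_div_lt_one {x R : ℝ} (hR : 0 < R) (h : |x| < R) : |x / R| < 1 := by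
  rw [abs_div, abs_of_pos hR]
  exact (div_lt_one hR).2 h

namespace IsLocalized

variable {e p : ℝ → ℝ → ℝ} {c : ℝ → ℝ} {E : ℝ}

/-- The weighted integral of a quantity controlled by a localized density agrees with the
plain integral, up to the tail, if the weight is `1` on the bulk. -/
lemma abs_integral_mul_sub_le (h : IsLocalized e c E) {J θ : ℝ → ℝ} {t D B ε : ℝ}
    (hJi : Integrable J) (hJ : ∀ᵐ x : ℝ, |J x| ≤ e t x) (hθc : Continuous θ)
    (hB : ∀ x, |θ x| ≤ B) (hθ : ∀ x, |x - c t| ≤ D → θ x = 1)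
    (htail : ∫ x in {x : ℝ | D < |x - c t|}, e t x ≤ ε) :
    |(∫ x, θ x * J x) - ∫ x, J x| ≤ (B + 1) * ε := by
  have hi : Integrable (fun x => θ x * J x) :=
    hJi.bdd_mul hθc.aestronglyMeasurable (Eventually.of_forall hB)
  rw [← integral_sub hi hJi]
  have e1 : ∫ x, (θ x * J x - J x) = ∫ x, (θ x - 1) * J x := by
    simp only [sub_mul, one_mul]
  rw [e1]
  refine abs_integral_mul_le_tail (h.nonneg t) (h.integrable t) hJ (fun x => ?_)
    (fun x hx => by rw [hθ x hx, sub_self]) htail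
  have := abs_sub (θ x) 1
  rw [abs_one] at this
  linarith [hB x]

lemma const_mul (h : IsLocalized e c E) {K : ℝ} (hK : 0 < K) :
    IsLocalized (fun t x => K * e t x) c (K * E) where
  nonneg t x := mul_nonneg hK.le (h.nonneg t x)
  integrable t := (h.integrable t).const_mul K
  integral_eq t := by rw [integral_const_mul, h.integral_eq]
  tail ε hε := by
    obtain ⟨D, hD0, hD⟩ := h.tail (ε / K) (div_pos hε hK)
    refine ⟨D, hD0, fun t => ?_⟩
    rw [integral_const_mul, mul_comm]
    exact (le_div_iff₀ hK).1 (hD t)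

/-- The total energy in a fixed large interval changes slowly, so the center moves at most
linearly in time. -/
lemma exists_linear_bound (h : IsLocalized e c E) (hE : 0 < E)
    (hpi : ∀ t, Integrable (p t)) (hp : ∀ t x, |p t x| ≤ e t x)
    (hd : ∀ φ : ℝ → ℝ, IsTest φ → ∀ t,
      HasDerivAt (fun s => ∫ x, φ x * e s x) (-∫ x, deriv φ x * p t x) t) :
    ∃ L C, 0 ≤ L ∧ 0 ≤ C ∧ ∀ T, 0 ≤ T → ∀ t ∈ Set.Icc 0 T, |c t| ≤ L * T + C := by
  obtain ⟨K, hK0, hK⟩ := isTest_cutoff.deriv.exists_bound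
  obtain ⟨D, hD0, hD⟩ := h.tail (E / 8) (by positivity)
  refine ⟨8 * K, 2 * |c 0| + 3 * D + 2, by positivity, by positivity, fun T hT t ht => ?_⟩
  -- At this scale the energy seen by the cutoff changes by at most `E / 4` up to time `T`, and
  -- it starts above `3 E / 4`; a center outside `[-2 R - D, 2 R + D]` leaves only `E / 8`.
  set R := 4 * K * T + |c 0| + D + 1 with hR
  have hR0 : 0 < R := by positivity
  have habs : ∀ s, ∫ x, |p s x| ≤ E := fun s => by
    rw [← h.integral_eq s]
    exact integral_mono (hpi s).abs (h.integrable s) (hp s)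
  have hT2 := isTest_cutoff.comp_div hR0
  have h1 : |(∫ x, cutoff (x / R) * e t x) - ∫ x, cutoff (x / R) * e 0 x| ≤ K / R * E * t := by
    refine abs_sub_le_of_hasDerivAt (fun t => hd _ hT2 t) (fun s _ => ?_) ht
    rw [abs_neg]
    refine (abs_integral_mul_le_of_abs_le (B := K / R) (hpi s) fun x => ?_).trans ?_
    · rw [isTest_cutoff.deriv_comp_div, abs_div, abs_of_pos hR0]
      gcongr
      exact hK _
    · have := habs s
      gcongr
  have h2 : K / R * E * t ≤ E / 4 := by
    have : K * t ≤ R / 4 := by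
      have := mul_le_mul_of_nonneg_left ht.2 hK0
      have := abs_nonneg (c 0)
      linarith
    rw [div_mul_eq_mul_div, div_mul_eq_mul_div, div_le_iff₀ hR0]
    nlinarith
  have h3 : |(∫ x, cutoff (x / R) * e 0 x) - ∫ x, e 0 x| ≤ (1 + 1) * (E / 8) := by
    refine h.abs_integral_mul_sub_le (h.integrable 0)
      (Eventually.of_forall fun x => (abs_of_nonneg (h.nonneg 0 x)).le) hT2.continuous
      (fun x => abs_cutoff_le_one _) (fun x hx => cutoff_eq_one (abs_div_lt_one hR0 ?_).le) (hD 0)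
    have := abs_sub_abs_le_abs_sub x (c 0)
    have : 0 ≤ 4 * K * T := by positivity
    linarith
  by_contra hcon
  rw [not_le] at hcon
  have h4 : |∫ x, cutoff (x / R) * e t x| ≤ 1 * (E / 8) := by
    refine abs_integral_mul_le_tail (h.nonneg t) (h.integrable t)
      (Eventually.of_forall fun x => (abs_of_nonneg (h.nonneg t x)).le)
      (fun x => abs_cutoff_le_one _)
      (fun x hx => cutoff_eq_zero ?_) (hD t)
    rw [abs_div, abs_of_pos hR0, le_div_iff₀ hR0]
    have := abs_sub_abs_le_abs_sub (c t) x
    rw [abs_sub_comm] at this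
    linarith
  rw [h.integral_eq] at h3
  have := abs_le.1 h1
  have := abs_le.1 h3
  have := abs_le.1 h4
  linarith

/-- If moreover the total momentum vanishes, the first moment of the energy is almost conserved,
and the center moves sublinearly in time. -/
lemma exists_sublinear_bound (h : IsLocalized e c E) (hE : 0 < E)
    (hpi : ∀ t, Integrable (p t)) (hp : ∀ t x, |p t x| ≤ e t x) (hp0 : ∀ t, ∫ x, p t x = 0)
    (hd : ∀ φ : ℝ → ℝ, IsTest φ → ∀ t,
      HasDerivAt (fun s => ∫ x, φ x * e s x) (-∫ x, deriv φ x * p t x) t)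
    {κ : ℝ} (hκ : 0 < κ) :
    ∃ C, 0 ≤ C ∧ ∀ T, 0 ≤ T → ∀ t ∈ Set.Icc 0 T, |c t| ≤ κ * T + C := by
  obtain ⟨L, C₁, hL0, hC₁, hL⟩ := h.exists_linear_bound hE hpi hp hd
  obtain ⟨K, hK0, hK⟩ := isTest_cutoffId.deriv.exists_bound
  set ε := κ * E / (K + 1 + 6 * L) with hε
  have hden : 0 < K + 1 + 6 * L := by positivity
  have hε0 : 0 < ε := by positivity
  obtain ⟨D, hD0, hD⟩ := h.tail ε hε0
  refine ⟨|c 0| + (2 * D * E + 6 * (C₁ + D + 1) * ε) / E, by positivity, fun T hT t ht => ?_⟩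
  set R := L * T + C₁ + D + 1 with hR
  have hR0 : 0 < R := by positivity
  have hbulk : ∀ s ∈ Set.Icc 0 T, ∀ x, |x - c s| ≤ D → |x| < R := by
    intro s hs x hx
    have := abs_sub_abs_le_abs_sub x (c s)
    have := hL T hT s hs
    linarith
  have hT2 := isTest_cutoffId.comp_div hR0
  have hid : ∀ x, |x| < R → R * cutoffId (x / R) = x := by
    intro x hx
    rw [cutoffId_of_abs_le (abs_div_lt_one hR0 hx).le]
    field_simp
  -- the truncated first moment of the energy
  set X : ℝ → ℝ := fun s => R * ∫ x, cutoffId (x / R) * e s x with hX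
  have hXd : ∀ s, HasDerivAt X (-∫ x, deriv cutoffId (x / R) * p s x) s := by
    intro s
    refine ((hd _ hT2 s).const_mul R).congr_deriv ?_
    rw [mul_neg, ← integral_const_mul]
    congr 1
    refine integral_congr_ae (Eventually.of_forall fun x => ?_)
    simp only [isTest_cutoffId.deriv_comp_div]
    field_simp
  have h1 : |X t - X 0| ≤ ((K + 1) * ε) * t := by
    refine abs_sub_le_of_hasDerivAt hXd (fun s hs => ?_) ht
    have := h.abs_integral_mul_sub_le (θ := fun x => deriv cutoffId (x / R)) (hpi s)
      (Eventually.of_forall (hp s))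
      (isTest_cutoffId.deriv.comp_div hR0).continuous (fun x => hK _)
      (fun x hx => deriv_cutoffId (abs_div_lt_one hR0 (hbulk s hs x hx))) (hD s)
    rw [abs_neg]
    rwa [hp0, sub_zero] at this
  have h2 : ∀ s ∈ Set.Icc 0 T, |X s - c s * E| ≤ D * E + 3 * R * ε := by
    intro s hs
    have i1 : Integrable (fun x => R * (cutoffId (x / R) * e s x)) :=
      (hT2.integrable_mul_of_integrable (h.integrable s)).const_mul R
    have i2 := (h.integrable s).const_mul (c s)
    have e1 : X s - c s * E = ∫ x, (R * cutoffId (x / R) - c s) * e s x := by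
      simp only [hX]
      rw [← h.integral_eq s, ← integral_const_mul, ← integral_const_mul, ← integral_sub i1 i2]
      refine integral_congr_ae (Eventually.of_forall fun x => ?_)
      simp only
      ring
    have e2 : D * E + 3 * R * ∫ x in {x : ℝ | D < |x - c s|}, e s x
        = ∫ x, (D * e s x + 3 * R * {x : ℝ | D < |x - c s|}.indicator (e s) x) := by
      rw [integral_add ((h.integrable s).const_mul D)
        (((h.integrable s).indicator (measurableSet_tail D (c s))).const_mul (3 * R)),
        integral_const_mul, integral_const_mul, h.integral_eq,
        integral_indicator (measurableSet_tail D (c s))]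
    have e3 : |X s - c s * E| ≤ D * E + 3 * R * ∫ x in {x : ℝ | D < |x - c s|}, e s x := by
      rw [e1, e2]
      refine norm_integral_le_of_norm_le
        (f := fun x => (R * cutoffId (x / R) - c s) * e s x)
        (((h.integrable s).const_mul D).add
        (((h.integrable s).indicator (measurableSet_tail D (c s))).const_mul (3 * R)))
        (Eventually.of_forall fun x => ?_)
      rw [Real.norm_eq_abs, abs_mul, abs_of_nonneg (h.nonneg s x)]
      by_cases hx : D < |x - c s|
      · rw [Set.indicator_of_mem (show x ∈ {x : ℝ | D < |x - c s|} from hx), ← add_mul]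
        refine mul_le_mul_of_nonneg_right ?_ (h.nonneg s x)
        have b1 := abs_sub (R * cutoffId (x / R)) (c s)
        have b2 := abs_cutoffId_le (x / R)
        have b3 : |c s| ≤ R := (hL T hT s hs).trans (by rw [hR]; linarith)
        rw [abs_mul, abs_of_pos hR0] at b1
        nlinarith
      · rw [Set.indicator_of_notMem (show x ∉ {x : ℝ | D < |x - c s|} from hx), mul_zero, add_zero,
          hid x (hbulk s hs x (not_lt.1 hx))]
        exact mul_le_mul_of_nonneg_right (not_lt.1 hx) (h.nonneg s x)
    refine e3.trans ?_
    have := hD s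
    gcongr
  have h3 : |c t - c 0| * E ≤ (K + 1 + 6 * L) * ε * T + (2 * D * E + 6 * (C₁ + D + 1) * ε) := by
    have a1 := abs_le.1 (h2 t ht)
    have a2 := abs_le.1 (h2 0 ⟨le_rfl, hT⟩)
    have a3 := abs_le.1 h1
    have a4 : (K + 1) * ε * t ≤ (K + 1) * ε * T := by
      have := ht.2
      gcongr
    rw [← abs_of_pos hE, ← abs_mul, abs_of_pos hE]
    have e5 : 6 * R * ε = 6 * L * ε * T + 6 * (C₁ + D + 1) * ε := by
      rw [hR]
      ring
    refine abs_le.2 ⟨?_, ?_⟩ <;> nlinarith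
  have h4 : (K + 1 + 6 * L) * ε = κ * E := by
    rw [hε]
    field_simp
  rw [h4] at h3
  have h5 : |c t - c 0| ≤ κ * T + (2 * D * E + 6 * (C₁ + D + 1) * ε) / E := by
    rw [← mul_le_mul_iff_left₀ hE, add_mul, div_mul_cancel₀ _ hE.ne']
    linarith
  have h6 := abs_sub_abs_le_abs_sub (c t) (c 0)
  linarith

/-- The virial argument. A localized density of positive mass and vanishing momentum is
incompatible with a virial identity: `p` has flux `l`, `q` has source `G` and flux `r`, and the
dissipation `l - G / 2` of the virial functional controls the energy up to a time derivative. -/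
lemma false_of_virial (h : IsLocalized e c E) (hE : 0 < E)
    (hpi : ∀ t, Integrable (p t)) (hp : ∀ t x, |p t x| ≤ e t x) (hp0 : ∀ t, ∫ x, p t x = 0)
    (hd : ∀ φ : ℝ → ℝ, IsTest φ → ∀ t,
      HasDerivAt (fun s => ∫ x, φ x * e s x) (-∫ x, deriv φ x * p t x) t)
    {l q G r : ℝ → ℝ → ℝ} {K A : ℝ} (hK1 : 1 ≤ K)
    (hli : ∀ t, Integrable (l t)) (hl : ∀ t x, |l t x| ≤ K * e t x)
    (hqi : ∀ t, Integrable (q t)) (hq : ∀ t x, |q t x| ≤ e t x)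
    (hGi : ∀ t, Integrable (G t)) (hG : ∀ t, ∀ᵐ x : ℝ, |G t x| ≤ K * e t x)
    (hr : ∀ t x, |r t x| ≤ e t x)
    (hdp : ∀ φ : ℝ → ℝ, IsTest φ → ∀ t,
      HasDerivAt (fun s => ∫ x, φ x * p s x) (-∫ x, deriv φ x * l t x) t)
    (hdq : ∀ φ : ℝ → ℝ, IsTest φ → ∀ t, HasDerivAt (fun s => ∫ x, φ x * q s x)
      ((∫ x, φ x * G t x) - ∫ x, deriv φ x * r t x) t)
    (hA0 : 0 < A)
    (hA : ∀ t, 3 / 2 * E ≤ (∫ x, G t x) + A * ∫ x, (l t x - G t x / 2)) : False := by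
  have h' := h.const_mul (show 0 < 2 * K by linarith)
  have hle : ∀ t x, e t x ≤ 2 * K * e t x := fun t x => by nlinarith [h.nonneg t x]
  have hdiss : ∀ t, ∀ᵐ x : ℝ, |l t x - G t x / 2| ≤ 2 * K * e t x := by
    intro t
    filter_upwards [hG t] with x hGx
    have b1 := abs_le.1 (hl t x)
    have b2 := abs_le.1 hGx
    have b3 : 0 ≤ K * e t x := mul_nonneg (by linarith) (h.nonneg t x)
    refine abs_le.2 ⟨?_, ?_⟩ <;> linarith
  obtain ⟨K₁, hK₁, hb₁⟩ := isTest_cutoffId.deriv.exists_bound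
  obtain ⟨K₂, hK₂, hb₂⟩ := isTest_cutoffId.deriv.deriv.exists_bound
  set ε := E / (2 * ((1 + A) * (K₁ + 1 + K₂))) with hε
  have hε0 : 0 < ε := by positivity
  obtain ⟨D, hD0, hD⟩ := h'.tail ε hε0
  obtain ⟨C, hC0, hC⟩ := h.exists_sublinear_bound hE hpi hp hp0 hd
    (show 0 < 1 / (8 * A) by positivity)
  -- At this time the growth `E T` of the functional exceeds its size.
  set T := 2 * (2 * K₁ + A * K₁ + 4 * A * (C + D + 1)) + 1 with hT
  have hT0 : 0 < T := by positivity
  set R := 1 / (8 * A) * T + C + D + 1 with hR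
  have hR1 : 1 ≤ R := by
    have : 0 ≤ 1 / (8 * A) * T := by positivity
    linarith
  have hR0 : 0 < R := by linarith
  have hbulk : ∀ s ∈ Set.Icc 0 T, ∀ x, |x - c s| ≤ D → |x / R| < 1 := by
    intro s hs x hx
    have := abs_sub_abs_le_abs_sub x (c s)
    have := hC T hT0.le s hs
    exact abs_div_lt_one hR0 (by linarith)
  have hφ := isTest_cutoffId.comp_div hR0
  have hθ := isTest_cutoffId.deriv.comp_div hR0
  set P : ℝ → ℝ := fun s => R * ∫ x, cutoffId (x / R) * p s x with hP
  set Q : ℝ → ℝ := fun s => ∫ x, deriv cutoffId (x / R) * q s x with hQ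
  have hPd : ∀ s, HasDerivAt P (-∫ x, deriv cutoffId (x / R) * l s x) s := by
    intro s
    refine ((hdp _ hφ s).const_mul R).congr_deriv ?_
    rw [mul_neg, ← integral_const_mul]
    congr 1
    refine integral_congr_ae (Eventually.of_forall fun x => ?_)
    simp only [isTest_cutoffId.deriv_comp_div]
    field_simp
  have hQd := hdq _ hθ
  have habs : ∀ {J : ℝ → ℝ → ℝ}, (∀ t, Integrable (J t)) → (∀ t x, |J t x| ≤ e t x) →
      ∀ t, ∫ x, |J t x| ≤ E := fun hi hJ t => by
    rw [← h.integral_eq t]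
    exact integral_mono (hi t).abs (h.integrable t) (hJ t)
  have hPb : ∀ s, |P s| ≤ 2 * R * E := by
    intro s
    rw [hP, abs_mul, abs_of_pos hR0]
    have := (abs_integral_mul_le_of_abs_le (hpi s) (fun x => abs_cutoffId_le (x / R))).trans
      (mul_le_mul_of_nonneg_left (habs hpi hp s) zero_le_two)
    calc _ ≤ R * (2 * E) := mul_le_mul_of_nonneg_left this hR0.le
      _ = _ := by ring
  have hQb : ∀ s, |Q s| ≤ K₁ * E := fun s =>
    (abs_integral_mul_le_of_abs_le (hqi s) (fun x => hb₁ (x / R))).trans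
      (mul_le_mul_of_nonneg_left (habs hqi hq s) hK₁)
  set Z : ℝ → ℝ := fun s => Q s - A * (P s + Q s / 2) with hZ
  have hZd := fun s => (hQd s).sub (((hPd s).add ((hQd s).div_const 2)).const_mul A)
  have hgrow : ∀ s ∈ Set.Icc 0 T, E ≤ deriv Z s := by
    intro s hs
    rw [show deriv Z s = _ from (hZd s).deriv]
    have hone : ∀ x, |x - c s| ≤ D → deriv cutoffId (x / R) = 1 :=
      fun x hx => deriv_cutoffId (hbulk s hs x hx)
    have a1 := h'.abs_integral_mul_sub_le (hGi s)
      ((hG s).mono fun x hx => hx.trans (by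
        have := mul_nonneg (by linarith : 0 ≤ K) (h.nonneg s x)
        linarith))
      hθ.continuous (fun x => hb₁ _) hone (hD s)
    have a2 := h'.abs_integral_mul_sub_le ((hli s).sub ((hGi s).div_const 2)) (hdiss s)
      hθ.continuous (fun x => hb₁ _) hone (hD s)
    have a3 : |∫ x, deriv (fun x => deriv cutoffId (x / R)) x * r s x| ≤ K₂ * ε := by
      refine abs_integral_mul_le_tail (h'.nonneg s) (h'.integrable s)
        (Eventually.of_forall fun x => (hr s x).trans (hle s x)) (fun x => ?_)
        (fun x hx => ?_) (hD s)
      · rw [isTest_cutoffId.deriv.deriv_comp_div, abs_div, abs_of_pos hR0]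
        exact (div_le_self (abs_nonneg _) hR1).trans (hb₂ _)
      · rw [isTest_cutoffId.deriv.deriv_comp_div, deriv_deriv_cutoffId (hbulk s hs x hx), zero_div]
    have e1 : ∫ x, deriv cutoffId (x / R) * (l s x - G s x / 2)
        = (∫ x, deriv cutoffId (x / R) * l s x) - (∫ x, deriv cutoffId (x / R) * G s x) / 2 := by
      rw [← integral_div, ← integral_sub (hθ.integrable_mul_of_integrable (hli s))
        ((hθ.integrable_mul_of_integrable (hGi s)).div_const 2)]
      refine integral_congr_ae (Eventually.of_forall fun x => ?_)
      simp only
      ring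
    have a2' : |(∫ x, deriv cutoffId (x / R) * (l s x - G s x / 2))
        - ∫ x, (l s x - G s x / 2)| ≤ (K₁ + 1) * ε := a2
    rw [e1] at a2'
    have a4 : (1 + A) * (K₁ + 1 + K₂) * ε = E / 2 := by
      rw [hε]
      field_simp
    have a5 := hA s
    have b1 := abs_le.1 a1
    have b2 := mul_le_mul_of_nonneg_left (abs_le.1 a2').1 hA0.le
    have b3 := abs_le.1 a3
    have b4 := mul_le_mul_of_nonneg_left (abs_le.1 a3).1 hA0.le
    have b5 : 0 ≤ A * (K₂ * ε) := by positivity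
    nlinarith
  have hZdiff : Differentiable ℝ Z := fun s => (hZd s).differentiableAt
  have hfin := Convex.mul_sub_le_image_sub_of_le_deriv (convex_Icc 0 T)
    hZdiff.continuous.continuousOn hZdiff.differentiableOn
    (fun s hs => hgrow s (interior_subset hs)) 0 (Set.left_mem_Icc.2 hT0.le) T
    (Set.right_mem_Icc.2 hT0.le) hT0.le
  have c1 := abs_le.1 (hQb T)
  have c2 := abs_le.1 (hQb 0)
  have c3 : ∀ s, |P s + Q s / 2| ≤ (2 * R + K₁ / 2) * E := by
    intro s
    have d1 := abs_le.1 (hPb s)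
    have d2 := abs_le.1 (hQb s)
    refine abs_le.2 ⟨?_, ?_⟩ <;> linarith
  have c4 := mul_le_mul_of_nonneg_left (abs_le.1 (c3 T)).1 hA0.le
  have c5 := mul_le_mul_of_nonneg_left (abs_le.1 (c3 0)).2 hA0.le
  have c6 : E * T ≤ (2 * K₁ + A * K₁ + 4 * A * R) * E := by
    simp only [hZ, sub_zero] at hfin
    linarith
  have c7 : 4 * A * R = T / 2 + 4 * A * (C + D + 1) := by
    rw [hR]
    field_simp
    ring
  rw [c7, mul_comm E, mul_le_mul_iff_left₀ hE] at c6
  linarith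

end IsLocalized

/-! ### Almost periodic solutions -/

section densities

variable (f g k : L2) (x : ℝ)

lemma energyDensity_nonneg : 0 ≤ energyDensity f g k x :=
  add_nonneg (by positivity) (potential_nonneg _)

lemma sq_add_sq_add_sq_le : k x ^ 2 + g x ^ 2 + f x ^ 2 ≤ 2 * energyDensity f g k x := by
  rw [energyDensity]
  linarith [sq_div_two_le_potential (f x)]

lemma abs_mul_le_energyDensity_kg : |k x * g x| ≤ energyDensity f g k x := by
  have := sq_add_sq_add_sq_le f g k x
  refine abs_le.2 ⟨?_, ?_⟩ <;>
    nlinarith [sq_nonneg (k x + g x), sq_nonneg (k x - g x), sq_nonneg (f x)]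

lemma abs_mul_le_energyDensity_fk : |f x * k x| ≤ energyDensity f g k x := by
  have := sq_add_sq_add_sq_le f g k x
  refine abs_le.2 ⟨?_, ?_⟩ <;>
    nlinarith [sq_nonneg (f x + k x), sq_nonneg (f x - k x), sq_nonneg (g x)]

lemma abs_mul_le_energyDensity_fg : |f x * g x| ≤ energyDensity f g k x := by
  have := sq_add_sq_add_sq_le f g k x
  refine abs_le.2 ⟨?_, ?_⟩ <;>
    nlinarith [sq_nonneg (f x + g x), sq_nonneg (f x - g x), sq_nonneg (k x)]

lemma abs_stressDensity_le : |stressDensity f g k x| ≤ energyDensity f g k x := by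
  have h1 := potential_nonneg (f x)
  have h2 : 0 ≤ (k x ^ 2 + g x ^ 2) / 2 := by positivity
  rw [energyDensity, stressDensity]
  refine abs_le.2 ⟨?_, ?_⟩ <;> linarith

end densities

namespace IsGlobalSolution

variable {u ux ut : ℝ → L2} (h : IsGlobalSolution u ux ut)
include h

lemma integral_energyDensity_eq (t : ℝ) :
    ∫ x, energyDensity (u t) (ux t) (ut t) x = ∫ x, energyDensity (u 0) (ux 0) (ut 0) x :=
  integral_eq_of_local_conservation (F := fun t => energyDensity (u t) (ux t) (ut t))
    h.integrable_energyDensity (fun t => integrable_mul (ut t) (ux t))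
    (h.continuous_ut.norm.mul h.continuous_ux.norm)
    (fun t => integral_abs_mul_le (ut t) (ux t)) (fun _ hφ t => h.hasDerivAt_energy hφ t) t

lemma integral_ut_mul_ux_eq (t : ℝ) :
    ∫ x, ut t x * ux t x = ∫ x, ut 0 x * ux 0 x :=
  integral_eq_of_local_conservation (F := fun t x => ut t x * ux t x)
    (J := fun t => stressDensity (u t) (ux t) (ut t))
    (b := fun _ => ∫ x, energyDensity (u 0) (ux 0) (ut 0) x)
    (fun t => integrable_mul (ut t) (ux t)) h.integrable_stressDensity continuous_const
    (fun t => by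
      rw [← h.integral_energyDensity_eq t]
      exact integral_mono (h.integrable_stressDensity t).abs (h.integrable_energyDensity t)
        fun x => abs_stressDensity_le _ _ _ _)
    (fun _ hφ t => h.hasDerivAt_momentum hφ t) t

lemma norm_sq_add_le (t : ℝ) : ‖ut t‖ ^ 2 + ‖ux t‖ ^ 2 + ‖u t‖ ^ 2 ≤
    2 * ∫ x, energyDensity (u 0) (ux 0) (ut 0) x := by
  rw [← h.integral_energyDensity_eq t, ← integral_sq_eq, ← integral_sq_eq, ← integral_sq_eq,
    ← integral_add_add (integrable_sq _) (integrable_sq _) (integrable_sq _),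
    ← integral_const_mul]
  exact integral_mono (((integrable_sq _).add (integrable_sq _)).add (integrable_sq _))
    ((h.integrable_energyDensity t).const_mul 2) fun x => sq_add_sq_add_sq_le _ _ _ _

/-- Energy conservation makes the solution bounded on space-time, so that potential and force
are quadratically bounded along it. -/
lemma exists_uniform_bound : ∃ K, 0 ≤ K ∧ ∀ t, ∀ᵐ x : ℝ,
    potential (u t x) ≤ K * u t x ^ 2 ∧ u t x * force (u t x) ≤ K * u t x ^ 2 := by
  set E := ∫ x, energyDensity (u 0) (ux 0) (ut 0) x
  obtain ⟨K, hK, -⟩ := exists_quadraticBound_potential √(2 * E)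
  refine ⟨K, hK.nonneg, fun t => ?_⟩
  filter_upwards [(h.weakDeriv t).ae_sq_le] with x hx
  have h1 : u t x ^ 2 ≤ 2 * E := by
    have := h.norm_sq_add_le t
    nlinarith [sq_nonneg (‖u t‖ - ‖ux t‖), sq_nonneg ‖ut t‖]
  have hS := abs_le.1 (Real.abs_le_sqrt h1)
  refine ⟨(le_abs_self _).trans (hK.bound _ hS), (le_abs_self _).trans ?_⟩
  rw [abs_mul]
  have := mul_le_mul_of_nonneg_left (hK.bound_deriv _ hS) (abs_nonneg (u t x))
  calc |u t x| * |force (u t x)| ≤ |u t x| * (K * |u t x|) := this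
    _ = K * |u t x| ^ 2 := by ring
    _ = K * u t x ^ 2 := by rw [sq_abs]

/-- The energy of an almost periodic solution is localized. -/
lemma exists_isLocalized (hap : AlmostPeriodicModTranslations u ux ut) :
    ∃ c, IsLocalized (fun t => energyDensity (u t) (ux t) (ut t)) c
      (∫ x, energyDensity (u 0) (ux 0) (ut 0) x) := by
  obtain ⟨c, C, hC0, hC⟩ := hap
  obtain ⟨K, hK0, hK⟩ := h.exists_uniform_bound
  refine ⟨c, fun t x => energyDensity_nonneg _ _ _ _, h.integrable_energyDensity,
    h.integral_energyDensity_eq, fun ε hε => ?_⟩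
  have hη : 0 < ε / (1 + K) := by positivity
  refine ⟨C (ε / (1 + K)), hC0 _ hη, fun t => ?_⟩
  have h1 := (hC t _ hη).1
  set S := {x : ℝ | C (ε / (1 + K)) < |x - c t|}
  have hi : Integrable (fun x => |u t x| ^ 2 + |ux t x| ^ 2 + |ut t x| ^ 2) := by
    simp only [sq_abs]
    exact ((integrable_sq _).add (integrable_sq _)).add (integrable_sq _)
  rw [← ofReal_integral_eq_lintegral_ofReal hi.integrableOn
    (Eventually.of_forall fun x => by positivity), ENNReal.ofReal_lt_ofReal_iff hη] at h1
  have h2 : ∫ x in S, energyDensity (u t) (ux t) (ut t) x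
      ≤ ∫ x in S, (1 + K) * (|u t x| ^ 2 + |ux t x| ^ 2 + |ut t x| ^ 2) := by
    refine integral_mono_ae (h.integrable_energyDensity t).integrableOn
      (hi.const_mul _).integrableOn ?_
    refine ae_restrict_of_ae ?_
    filter_upwards [hK t] with x hx
    simp only [sq_abs, energyDensity]
    nlinarith [hx.1, sq_nonneg (u t x), mul_nonneg hK0 (sq_nonneg (ux t x)),
      mul_nonneg hK0 (sq_nonneg (ut t x)), sq_nonneg (ux t x), sq_nonneg (ut t x)]
  rw [integral_const_mul] at h2
  refine h2.trans ?_
  have h3 := (lt_div_iff₀' (show 0 < 1 + K by positivity)).1 h1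
  exact h3.le

/-- Quantitative form of the compactness in `H¹`: the mass is controlled by `‖u_x‖`, because a
localized function with a small derivative is small. -/
lemma norm_sq_le_of_tail {t c D ε : ℝ} (hD : 0 ≤ D)
    (htail : ∫ x in {x : ℝ | D < |x - c|}, energyDensity (u t) (ux t) (ut t) x ≤ ε) :
    ‖u t‖ ^ 2 ≤ 4 * ε + 16 * D ^ 2 * ‖ux t‖ ^ 2 := by
  set S := {x : ℝ | D < |x - c|} with hS
  have hSm : MeasurableSet S := measurableSet_tail D c
  have hSc : Sᶜ = Metric.closedBall c D := by
    ext x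
    simp [hS, Real.dist_eq]
  have h1 : ∫ x in S, u t x ^ 2 ≤ 2 * ε := by
    have : ∫ x in S, u t x ^ 2 ≤ ∫ x in S, 2 * energyDensity (u t) (ux t) (ut t) x :=
      integral_mono (integrable_sq _).integrableOn
        ((h.integrable_energyDensity t).const_mul 2).integrableOn fun x => by
          have := sq_add_sq_add_sq_le (u t) (ux t) (ut t) x
          nlinarith [sq_nonneg (ux t x), sq_nonneg (ut t x)]
    rw [integral_const_mul] at this
    linarith
  have h2 : ∫ x in Sᶜ, u t x ^ 2 ≤ (2 * ‖u t‖ * ‖ux t‖) * (2 * D) := by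
    rw [hSc]
    have hvol : volume.real (Metric.closedBall c D) = 2 * D := by
      rw [Measure.real, Real.volume_closedBall, ENNReal.toReal_ofReal (by positivity)]
    rw [← hvol]
    refine (le_abs_self _).trans (norm_setIntegral_le_of_norm_le_const_ae
      (f := fun x => u t x ^ 2) measure_closedBall_lt_top ?_)
    filter_upwards [ae_restrict_of_ae (h.weakDeriv t).ae_sq_le] with x hx
    rwa [Real.norm_of_nonneg (sq_nonneg _)]
  have h3 := integral_add_compl hSm (integrable_sq (u t))
  rw [integral_sq_eq] at h3
  nlinarith [sq_nonneg (‖u t‖ - 4 * D * ‖ux t‖)]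

/-- An almost periodic solution with zero momentum has zero energy. -/
lemma energy_eq_zero (hap : AlmostPeriodicModTranslations u ux ut)
    (hmom : momentum (ux 0) (ut 0) = 0) :
    ∫ x, energyDensity (u 0) (ux 0) (ut 0) x = 0 := by
  obtain ⟨c, hloc⟩ := h.exists_isLocalized hap
  obtain ⟨K, hK0, hK⟩ := h.exists_uniform_bound
  set E := ∫ x, energyDensity (u 0) (ux 0) (ut 0) x with hE
  by_contra hne
  have hE0 : 0 < E := lt_of_le_of_ne (integral_nonneg fun x => energyDensity_nonneg _ _ _ _)
    (Ne.symm hne)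
  have hp0 : ∀ t, ∫ x, ut t x * ux t x = 0 := fun t => by
    rw [h.integral_ut_mul_ux_eq t]
    exact neg_eq_zero.1 hmom
  obtain ⟨D, hD0, hD⟩ := hloc.tail (E / (24 * (K + 1))) (by positivity)
  have iuf : ∀ t, Integrable (fun x => u t x * force (u t x)) := fun t =>
    (Lp.memLp (u t)).integrable_mul (h.memLp_force t)
  have hGi : ∀ t, Integrable (fun x => ut t x ^ 2 - ux t x ^ 2 - u t x * force (u t x)) :=
    fun t => ((integrable_sq _).sub (integrable_sq _)).sub (iuf t)
  -- `A` is the constant in `∫ G ≥ 3/2 E - A ‖u_x‖²`, which comes from `norm_sq_le_of_tail`.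
  refine hloc.false_of_virial (K := 2 + 2 * K) (A := 2 + 48 * K * D ^ 2) hE0
    (p := fun t x => ut t x * ux t x) (l := fun t => stressDensity (u t) (ux t) (ut t))
    (q := fun t x => u t x * ut t x) (r := fun t x => u t x * ux t x)
    (G := fun t x => ut t x ^ 2 - ux t x ^ 2 - u t x * force (u t x))
    (fun t => integrable_mul _ _) (fun t x => abs_mul_le_energyDensity_kg _ _ _ _) hp0
    (fun φ hφ t => h.hasDerivAt_energy hφ t) (by linarith) h.integrable_stressDensity
    (fun t x => ?_) (fun t => integrable_mul _ _)
    (fun t x => abs_mul_le_energyDensity_fk _ _ _ _) hGi (fun t => ?_)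
    (fun t x => abs_mul_le_energyDensity_fg _ _ _ _)
    (fun φ hφ t => h.hasDerivAt_momentum hφ t)
    (fun φ hφ t => h.hasDerivAt_integral_mul_u_ut hφ t) (by positivity) (fun t => ?_)
  · have := energyDensity_nonneg (u t) (ux t) (ut t) x
    nlinarith [abs_stressDensity_le (u t) (ux t) (ut t) x, mul_nonneg hK0 this]
  · filter_upwards [hK t] with x hx
    have h1 := two_mul_potential_le (u t x)
    have h2 := sq_div_two_le_potential (u t x)
    have h3 := mul_le_mul_of_nonneg_left h2 hK0
    rw [energyDensity]
    have h4 : 0 ≤ K * ((ut t x ^ 2 + ux t x ^ 2) / 2) := by positivity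
    refine abs_le.2 ⟨?_, ?_⟩ <;>
      nlinarith [hx.2, sq_nonneg (ut t x), sq_nonneg (ux t x), sq_nonneg (u t x)]
  · have hmass := h.norm_sq_le_of_tail hD0.le (hD t)
    have h1 : ‖ux t‖ ^ 2 ≤ ∫ x, (stressDensity (u t) (ux t) (ut t) x
        - (ut t x ^ 2 - ux t x ^ 2 - u t x * force (u t x)) / 2) := by
      rw [← integral_sq_eq]
      refine integral_mono (integrable_sq _)
        ((h.integrable_stressDensity t).sub ((hGi t).div_const 2)) fun x => ?_
      have := two_mul_potential_le (u t x)
      simp only [stressDensity]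
      linarith
    have h2 : 2 * E - 2 * ‖ux t‖ ^ 2 - 3 * K * ‖u t‖ ^ 2
        ≤ ∫ x, (ut t x ^ 2 - ux t x ^ 2 - u t x * force (u t x)) := by
      have i1 := (h.integrable_energyDensity t).const_mul 2
      have i2 := (integrable_sq (ux t)).const_mul 2
      have i3 := (integrable_sq (u t)).const_mul (3 * K)
      rw [hE, ← h.integral_energyDensity_eq t, ← integral_sq_eq, ← integral_sq_eq,
        ← integral_const_mul, ← integral_const_mul, ← integral_const_mul,
        ← integral_sub_sub i1 i2 i3]
      refine integral_mono_ae ((i1.sub i2).sub i3) (hGi t) ?_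
      filter_upwards [hK t] with x hx
      simp only [energyDensity]
      linarith [hx.1, hx.2]
    have h3 := mul_le_mul_of_nonneg_left h1 (show 0 ≤ 2 + 48 * K * D ^ 2 by positivity)
    have h4 := mul_le_mul_of_nonneg_left hmass (show 0 ≤ 3 * K by positivity)
    have h5 : 12 * K * (E / (24 * (K + 1))) ≤ E / 2 := by
      rw [← mul_div_assoc, div_le_div_iff₀ (by positivity) two_pos]
      nlinarith
    nlinarith

lemma eq_zero_of_energy_eq_zero
    (hE : ∫ x, energyDensity (u 0) (ux 0) (ut 0) x = 0) (t : ℝ) : u t = 0 ∧ ut t = 0 := by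
  have h1 := h.norm_sq_add_le t
  rw [hE, mul_zero] at h1
  constructor <;> rw [← norm_eq_zero] <;> refine pow_eq_zero_iff two_ne_zero |>.1 ?_ <;>
    nlinarith [sq_nonneg ‖u t‖, sq_nonneg ‖ut t‖, sq_nonneg ‖ux t‖]

end IsGlobalSolution

/-! ### The zero solution scatters -/

lemma fourier_zero (ξ : ℝ) : fourier 0 ξ = 0 := by
  have h1 : (Complex.ofRealCLM.compLp (0 : L2) : Lp ℂ 2 (volume : Measure ℝ)) = 0 :=
    map_zero (Complex.ofRealCLM.compLpL 2 (volume : Measure ℝ))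
  have h2 : FourierTransform.fourier (0 : Lp ℂ 2 (volume : Measure ℝ)) = 0 :=
    map_zero (Lp.fourierTransformₗᵢ ℝ ℂ)
  simp [fourier, h1, h2]

lemma scatters_zero : Scatters (fun _ => 0) (fun _ => 0) := by
  have hlin : ∀ t, distToLinear 0 0 0 0 t = 0 := fun t => by
    simp [distToLinear, fourier_zero]
  have hmem : MemH1 0 := ⟨0, fun φ hφ => by
    rw [← inner_testLp _ hφ.deriv, ← inner_testLp _ hφ]
    simp⟩
  have hsc : ∀ l : Filter ℝ, ScattersAlong (fun _ => 0) (fun _ => 0) l := fun l =>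
    ⟨0, 0, hmem, by simp only [hlin]; exact tendsto_const_nhds⟩
  refine ⟨fun s _ _ => ⟨fun _ => 0, fun t => ?_, ?_⟩, hsc _, hsc _⟩
  · simp [IsBesselPotential, fourier_zero]
  · simp

end NLKG

theorem theorem8p1 :
    ¬ ∃ u ux ut : ℝ → NLKG.L2,
      NLKG.IsGlobalSolution u ux ut ∧
      NLKG.AlmostPeriodicModTranslations u ux ut ∧
      NLKG.momentum (ux 0) (ut 0) = 0 ∧
      ¬ NLKG.Scatters u ut := by
  rintro ⟨u, ux, ut, h, hap, hmom, hns⟩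
  have h0 := h.eq_zero_of_energy_eq_zero (h.energy_eq_zero hap hmom)
  refine hns ?_
  rw [show u = fun _ => 0 from funext fun t => (h0 t).1,
    show ut = fun _ => 0 from funext fun t => (h0 t).2]
  exact NLKG.scatters_zero
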